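/- Let $d\ge 1$, $0\le s^*\le d$, $M>0$, $\alpha\in(0,1]$, $c_L>0$ and $0<\underline c\le 1\le\overline c$. Let $\mathcal F$ be the set of all probability distributions $\mathrm P$ of $(X,Y)$ on $[0,1]^d\times[-M,M]$ such that $X$ has a Lebesgue density on $[0,1]^d$ with values in $[\underline c,\overline c]$, and the regression function $f^*(x)=\mathbb E(Y\mid X=x)$ has a version with $|f^*(x_1)-f^*(x_2)|\le c_L\|x_1-x_2\|_2^{\alpha}$ for all $x_1,x_2\in[0,1]^d$. For measurable $f:[0,1]^d\to\mathbb R$ let $\mathcal R_{\mathrm P}(f)=\int (y-f(x))^2\,d\mathrm P(x,y)$, and let $\mathcal R^*_{\mathrm P}=\inf_f\mathcal R_{\mathrm P}(f)$. Suppose that every user protects exactly the first $s^*$ features $x^{\mathrm{priv}}=(x^1,\dots,x^{s^*})$ and the label $y$, while the features $x^{\mathrm{pub}}=(x^{s^*+1},\dots,x^d)$ are public. A sequentially-interactive mechanism for $n$ users with outputs in a measurable space $\mathcal S$ consists of Markov kernels $\mathrm R_i(\cdot\mid x^{\mathrm{priv}},x^{\mathrm{pub}},y,z_{1:i-1})$,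 $1\le i\le n$, where $z_{1:i-1}=(z_1,\dots,z_{i-1})\in\mathcal S^{i-1}$. The observations $(X_i,Y_i)$ are i.i.d. with law $\mathrm P$, and $Z_i$ is drawn from $\mathrm R_i(\cdot\mid X_i^{\mathrm{priv}},X_i^{\mathrm{pub}},Y_i,Z_{1:i-1})$. The mechanism is $\varepsilon$-semi-feature LDP if $$\mathrm R_i(A\mid x^{\mathrm{priv}},x^{\mathrm{pub}},y,z_{1:i-1})\le e^{\varepsilon}\,\mathrm R_i(A\mid x^{\mathrm{priv}\prime},x^{\mathrm{pub}},y',z_{1:i-1})$$ for all $i$, all measurable $A\subset\mathcal S$, and all $x^{\mathrm{priv}},x^{\mathrm{priv}\prime},x^{\mathrm{pub}},y,y',z_{1:i-1}$. An estimator $\widehat f$ is called sequentially-interactive $\varepsilon$-semi-feature LDP if it is a (jointly measurable) function of the outputs $(Z_1,\dots,Z_n)$ of such a mechanism, for some $\mathcal S$; the outputs may contain the public features. Theorem. There is a constant $c>0$, depending only on $d,s^*,M,\alpha,c_L,\underline c,\overline c$, such that for all $n\ge1$ and all $\varepsilon>0$ $$\inf_{\widehat f}\ \sup_{\mathrm P\in\mathcal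 F}\ \mathbb E\left[\mathcal R_{\mathrm P}(\widehat f)-\mathcal R^*_{\mathrm P}\right]\ \ge\ c\left(\min\left\{1,\ \left(n(e^{\varepsilon}-1)^2\right)^{-\frac{2\alpha}{2\alpha+d+s^*}}\right\}\ \vee\ n^{-\frac{2\alpha}{2\alpha+d}}\right),$$ where the infimum is over all sequentially-interactive $\varepsilon$-semi-feature LDP estimators. In particular, whenever $n(e^\varepsilon-1)^2\ge1$, the lower bound is $c\,\big((n(e^{\varepsilon}-1)^2)^{-2\alpha/(2\alpha+d+s^*)}\vee n^{-2\alpha/(2\alpha+d)}\big)$. -/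

import Mathlib

open MeasureTheory ProbabilityTheory
open scoped ENNReal

universe u

/-- The feature space `[0,1]^d`. -/
abbrev Cube (d : ℕ) : Type := Fin d → unitInterval

/-- The label space `[-M, M]`. -/
abbrev Label (M : ℝ) : Type := Set.Icc (-M) M

/-- A labelled observation `(x, y)` in `[0,1]^d × [-M, M]`. -/
abbrev Sample (d : ℕ) (M : ℝ) : Type := Cube d × Label M

/-- `f` is a version of the regression function `x ↦ E[Y | X = x]` under `P`. -/
def IsRegressionFunction {d : ℕ} {M : ℝ} (P : Measure (Sample d M)) (f : Cube d → ℝ) : Prop :=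
  P[fun w : Sample d M => (w.2 : ℝ) |
      MeasurableSpace.comap (Prod.fst : Sample d M → Cube d) inferInstance]
    =ᵐ[P] fun w => f w.1

/-- `f` is `α`-Hölder on the cube with constant `cL`, for the Euclidean norm. -/
def IsHolder {d : ℕ} (α cL : ℝ) (f : Cube d → ℝ) : Prop :=
  ∀ x₁ x₂ : Cube d,
    |f x₁ - f x₂| ≤ cL * ‖WithLp.toLp 2 (fun ℓ : Fin d => (x₁ ℓ : ℝ) - (x₂ ℓ : ℝ))‖ ^ α

/-- The class of probability distributions of `(X, Y)` on `[0,1]^d × [-M, M]` such that `X` has a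
Lebesgue density with values in `[cLow, cUp]` and the regression function is `α`-Hölder
with constant `cL`. -/
structure InClass {d : ℕ} {M : ℝ} (α cL cLow cUp : ℝ) (P : Measure (Sample d M)) : Prop where
  isProbabilityMeasure : IsProbabilityMeasure P
  density : ∃ p : Cube d → ℝ, Measurable p ∧ (∀ x, cLow ≤ p x ∧ p x ≤ cUp) ∧
    P.map Prod.fst = (volume : Measure (Cube d)).withDensity fun x => ENNReal.ofReal (p x)
  holder : ∃ f : Cube d → ℝ, IsRegressionFunction P f ∧ IsHolder α cL f

/-- The least-squares risk `∫ (y - f(x))² dP(x, y)`, with values in `[0, ∞]`. -/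
noncomputable def leastSquaresRisk {d : ℕ} {M : ℝ} (P : Measure (Sample d M)) (f : Cube d → ℝ) : ℝ≥0∞ :=
  ∫⁻ w, ENNReal.ofReal (((w.2 : ℝ) - f w.1) ^ 2) ∂P

/-- The Bayes risk: the smallest risk over all measurable decision functions. -/
noncomputable def bayesLeastSquaresRisk {d : ℕ} {M : ℝ} (P : Measure (Sample d M)) : ℝ≥0∞ :=
  ⨅ (f : Cube d → ℝ) (_ : Measurable f), leastSquaresRisk P f

/-- The excess risk. For a probability measure `P` the Bayes risk is finite (at most `M²`) and is
at most the risk of every measurable `f`, so the subtraction is the true one. -/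
noncomputable def excessRisk {d : ℕ} {M : ℝ} (P : Measure (Sample d M)) (f : Cube d → ℝ) : ℝ≥0∞ :=
  leastSquaresRisk P f - bayesLeastSquaresRisk P

/-- A sequentially interactive mechanism for `n` users with outputs in `S`: user `i` releases
`Z_i ∈ S` drawn from a distribution that depends on `(X_i, Y_i)` and on the earlier
outputs `Z_j`, `j < i`. -/
structure SeqMechanism (d n : ℕ) (M : ℝ) (S : Type u) [MeasurableSpace S] where
  kernel : (i : Fin n) → Kernel (Sample d M × (Fin (i : ℕ) → S)) S
  isMarkovKernel : ∀ i, IsMarkovKernel (kernel i)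

namespace SeqMechanism

variable {d n : ℕ} {M : ℝ} {S : Type u} [MeasurableSpace S]

/-- `ε`-semi-feature local differential privacy for the privacy preferences `W`, where `W i ℓ` says
that user `i` protects the feature `ℓ`: the output distribution changes by a factor of at
most `e^ε` when the protected features and the label are changed and the public features
are kept. (Written multiplicatively, so that `0/0` counts as a ratio of `1`.) -/
def IsSemiFeatureLDP (R : SeqMechanism d n M S) (W : Fin n → Fin d → Prop) (ε : ℝ) : Prop :=
  ∀ (i : Fin n) (A : Set S), MeasurableSet A →
    ∀ (x x' : Cube d), (∀ ℓ, ¬ W i ℓ → x ℓ = x' ℓ) →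
      ∀ (y y' : Label M) (z : Fin (i : ℕ) → S),
        R.kernel i ((x, y), z) A ≤ ENNReal.ofReal (Real.exp ε) * R.kernel i ((x', y'), z) A

/-- The law of `(Z_1, …, Z_k)` when the observations are i.i.d. with law `P`: given the earlier
outputs, a new observation is drawn from `P` independently of them, and the next output is
drawn from the mechanism. -/
noncomputable def transcriptLaw (R : SeqMechanism d n M S) (P : Measure (Sample d M)) :
    (k : ℕ) → k ≤ n → Measure (Fin k → S)
  | 0, _ => Measure.dirac Fin.elim0
  | k + 1, h =>
      ((P.prod (R.transcriptLaw P k (Nat.le_of_succ_le h))).compProd (R.kernel ⟨k, h⟩)).map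
        fun q => Fin.snoc (α := fun _ => S) q.1.2 q.2

end SeqMechanism

/-- The aligned privacy preference: every user protects exactly the first `s` features. -/
def alignedMask (d n s : ℕ) : Fin n → Fin d → Prop := fun _ ℓ => (ℓ : ℕ) < s

/-- A sequentially interactive `ε`-semi-feature LDP estimator (aligned preference, `s` private
features): a private mechanism together with a measurable map from the outputs to regression
functions. The output space `S` is arbitrary and the outputs may contain the public features
and additional randomness. -/
structure SemiFeatureLDPEstimator (d s n : ℕ) (M ε : ℝ) : Type (u + 1) where
  S : Type u
  [measurableSpace : MeasurableSpace S]
  mechanism : SeqMechanism d n M S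
  isLDP : mechanism.IsSemiFeatureLDP (alignedMask d n s) ε
  estimate : (Fin n → S) → Cube d → ℝ
  measurable_estimate : Measurable (Function.uncurry estimate)

attribute [instance] SemiFeatureLDPEstimator.measurableSpace

/-- The expected excess risk of an estimator when the `n` observations are i.i.d. with law `P`. -/
noncomputable def SemiFeatureLDPEstimator.expectedExcessRisk {d s n : ℕ} {M ε : ℝ}
    (e : SemiFeatureLDPEstimator.{u} d s n M ε) (P : Measure (Sample d M)) : ℝ≥0∞ :=
  ∫⁻ z, excessRisk P (e.estimate z) ∂(e.mechanism.transcriptLaw P n le_rfl)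

/-- The minimax expected excess risk: infimum over the private estimators of the supremum over the
class of distributions. -/
noncomputable def semiFeatureMinimaxRisk (d s n : ℕ) (M ε α cL cLow cUp : ℝ) : ℝ≥0∞ :=
  ⨅ e : SemiFeatureLDPEstimator.{u} d s n M ε,
    ⨆ (P : Measure (Sample d M)) (_ : InClass α cL cLow cUp P), e.expectedExcessRisk P

/-! This is Assouad's method on a hypercube of regression functions. Take X uniform and Y in {M,
-M}, and let the regression function carry one signed bump of width and height of order 1/N and
N^(-α) on each of N^d cells (`signedBumps`). An estimator that gets a constant fraction of the signs
wrong pays an excess risk of order N^(-2α), so N should be as large as possible while flipping one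
sign stays undetectable from the n outputs.

The information bound is a χ² bound in variational form (`ChiSqBound`), which needs no densities and
multiplies along sequential interaction (`chiSqBound_transcriptLaw`). For one output, a flip changes
the mean of a test function g by an integral over one cell of the effect of the label on the output.
Privacy, with k = e^ε - 1, bounds this effect at x by k times the mass of |g| at every x' with the
same public features (`LabelSensitive`). It is therefore bounded by the average over all private
features. The private coordinates of the cell then contribute their full volume N^(-s), where
Cauchy-Schwarz would give only its square root, and Cauchy-Schwarz in the public ones gives
N^(-(d-s)/2). After squaring, the volume factor is N^(-(d+s)) (`sq_setLIntegral_box_le`), and the χ²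
cost per user is at most 2 k² N^(-(2α+d+s)) (`chiSqBound_comp_twoPointLaw`).

Choosing N with n k² N^(-(2α+d+s)) of order 1 gives the private rate. The non-private rate is the
same argument with s = 0 and k = 1, since the triangle inequality makes every mechanism sensitive
with these parameters (`labelSensitive_zero_one`). -/

/-! ### Laws with uniform X and two labels, and their excess risk -/

section TwoPointLaw

variable {d : ℕ} {M : ℝ}

/-- The largest label. -/
def topLabel (hM : 0 < M) : Label M := ⟨M, by constructor <;> linarith⟩

/-- The smallest label. -/
def botLabel (hM : 0 < M) : Label M := ⟨-M, by constructor <;> linarith⟩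

/-- The law of `(X, Y)` with `X` uniform on the cube, `Y ∈ {M, -M}` and regression function `f`. -/
noncomputable def twoPointLaw (hM : 0 < M) (f : Cube d → ℝ) : Measure (Sample d M) :=
  (volume.withDensity fun x => ENNReal.ofReal ((1 + f x / M) / 2)).map (fun x => (x, topLabel hM)) +
  (volume.withDensity fun x => ENNReal.ofReal ((1 - f x / M) / 2)).map (fun x => (x, botLabel hM))

theorem abs_div_le_one (hM : 0 < M) {f : Cube d → ℝ} (hf : ∀ x, |f x| ≤ M) (x : Cube d) :
    -1 ≤ f x / M ∧ f x / M ≤ 1 := by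
  have h := abs_le.mp (hf x)
  constructor
  · rw [le_div_iff₀ hM]; linarith [h.1]
  · rw [div_le_iff₀ hM]; linarith [h.2]

theorem lintegral_twoPointLaw (hM : 0 < M) {f : Cube d → ℝ} (hf : Measurable f)
    {g : Sample d M → ℝ≥0∞} (hg : Measurable g) :
    ∫⁻ w, g w ∂(twoPointLaw hM f) =
      ∫⁻ x, (ENNReal.ofReal ((1 + f x / M) / 2) * g (x, topLabel hM) +
        ENNReal.ofReal ((1 - f x / M) / 2) * g (x, botLabel hM)) := by
  have h1 : Measurable fun x : Cube d => (x, topLabel hM) := by fun_prop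
  have h2 : Measurable fun x : Cube d => (x, botLabel hM) := by fun_prop
  have m1 : Measurable fun x : Cube d => ENNReal.ofReal ((1 + f x / M) / 2) := by fun_prop
  have m2 : Measurable fun x : Cube d => ENNReal.ofReal ((1 - f x / M) / 2) := by fun_prop
  rw [twoPointLaw, lintegral_add_measure, lintegral_map hg h1, lintegral_map hg h2,
    lintegral_withDensity_eq_lintegral_mul _ m1 (g := fun x => g (x, topLabel hM)) (hg.comp h1),
    lintegral_withDensity_eq_lintegral_mul _ m2
      (g := fun x => g (x, botLabel hM)) (hg.comp h2), lintegral_add_left]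
  · rfl
  · exact m1.mul (hg.comp h1)

theorem isProbabilityMeasure_twoPointLaw (hM : 0 < M) {f : Cube d → ℝ} (hf : Measurable f)
    (hb : ∀ x, |f x| ≤ M) : IsProbabilityMeasure (twoPointLaw hM f) := by
  constructor
  have := lintegral_twoPointLaw hM hf (g := fun _ => 1) measurable_const
  rw [lintegral_one] at this
  rw [this]
  have : ∀ x, ENNReal.ofReal ((1 + f x / M) / 2) * 1 + ENNReal.ofReal ((1 - f x / M) / 2) * 1
      = 1 := by
    intro x
    have := abs_div_le_one hM hb x
    rw [mul_one, mul_one, ← ENNReal.ofReal_add (by linarith) (by linarith), ← ENNReal.ofReal_one]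
    congr 1; ring
  simp only [this, lintegral_one, measure_univ]

theorem map_fst_twoPointLaw (hM : 0 < M) {f : Cube d → ℝ} (hf : Measurable f)
    (hb : ∀ x, |f x| ≤ M) : (twoPointLaw hM f).map Prod.fst = volume := by
  ext B hB
  rw [Measure.map_apply measurable_fst hB, ← lintegral_indicator_one (measurable_fst hB),
    lintegral_twoPointLaw hM hf (measurable_one.indicator (measurable_fst hB)),
    ← lintegral_indicator_one hB]
  congr 1; ext x
  have := abs_div_le_one hM hb x
  by_cases hx : x ∈ B
  · simp only [Set.indicator, Set.mem_preimage, hx, if_true, Pi.one_apply, mul_one]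
    rw [← ENNReal.ofReal_add (by linarith) (by linarith), ← ENNReal.ofReal_one]
    congr 1; ring
  · simp [Set.indicator, hx]

theorem integral_twoPointLaw (hM : 0 < M) {f : Cube d → ℝ} (hf : Measurable f)
    (hb : ∀ x, |f x| ≤ M) {g : Sample d M → ℝ} (hg : Measurable g) {C : ℝ}
    (hC : ∀ w, |g w| ≤ C) :
    ∫ w, g w ∂(twoPointLaw hM f) =
      ∫ x, ((1 + f x / M) / 2 * g (x, topLabel hM) + (1 - f x / M) / 2 * g (x, botLabel hM)) := by
  have h1 : Measurable fun x : Cube d => (x, topLabel hM) := by fun_prop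
  have h2 : Measurable fun x : Cube d => (x, botLabel hM) := by fun_prop
  have m1 : Measurable fun x : Cube d => ENNReal.ofReal ((1 + f x / M) / 2) := by fun_prop
  have m2 : Measurable fun x : Cube d => ENNReal.ofReal ((1 - f x / M) / 2) := by fun_prop
  have := isProbabilityMeasure_twoPointLaw hM hf hb
  have hi : Integrable g (twoPointLaw hM f) :=
    Integrable.of_bound hg.aestronglyMeasurable C (Filter.Eventually.of_forall hC)
  have hA := hi
  rw [twoPointLaw, integrable_add_measure] at hA
  have hp := abs_div_le_one hM hb
  rw [twoPointLaw, integral_add_measure hA.1 hA.2, integral_map h1.aemeasurable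
    hg.aestronglyMeasurable, integral_map h2.aemeasurable hg.aestronglyMeasurable,
    integral_withDensity_eq_integral_toReal_smul m1 (by simp),
    integral_withDensity_eq_integral_toReal_smul m2 (by simp), ← integral_add]
  · congr 1; ext x
    rw [ENNReal.toReal_ofReal (by linarith [hp x]), ENNReal.toReal_ofReal (by linarith [hp x])]
    rfl
  · refine Integrable.of_bound (C := C)
      (m1.ennreal_toReal.smul (hg.comp h1)).aestronglyMeasurable (Filter.Eventually.of_forall ?_)
    intro x
    rw [ENNReal.toReal_ofReal (by linarith [hp x]), norm_smul, Real.norm_eq_abs, Real.norm_eq_abs,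
      abs_of_nonneg (by linarith [hp x])]
    nlinarith [hp x, hC (x, topLabel hM), abs_nonneg (g (x, topLabel hM))]
  · refine Integrable.of_bound (C := C)
      (m2.ennreal_toReal.smul (hg.comp h2)).aestronglyMeasurable (Filter.Eventually.of_forall ?_)
    intro x
    rw [ENNReal.toReal_ofReal (by linarith [hp x]), norm_smul, Real.norm_eq_abs, Real.norm_eq_abs,
      abs_of_nonneg (by linarith [hp x])]
    nlinarith [hp x, hC (x, botLabel hM), abs_nonneg (g (x, botLabel hM))]

/-- Given x, the label has mean M (1 + f x / M) / 2 - M (1 - f x / M) / 2 = f x. -/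
theorem isRegressionFunction_twoPointLaw (hM : 0 < M) {f : Cube d → ℝ} (hf : Measurable f)
    (hb : ∀ x, |f x| ≤ M) : IsRegressionFunction (twoPointLaw hM f) f := by
  have := isProbabilityMeasure_twoPointLaw hM hf hb
  have hle : MeasurableSpace.comap (Prod.fst : Sample d M → Cube d) inferInstance ≤
      (inferInstance : MeasurableSpace (Sample d M)) := measurable_fst.comap_le
  have hY : ∀ w : Sample d M, |(w.2 : ℝ)| ≤ M := fun w => abs_le.mpr w.2.2
  have mY : Measurable fun w : Sample d M => (w.2 : ℝ) := by fun_prop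
  have mf : Measurable fun w : Sample d M => f w.1 := by fun_prop
  unfold IsRegressionFunction
  symm
  refine ae_eq_condExp_of_forall_setIntegral_eq hle ?_ ?_ ?_ ?_
  · exact Integrable.of_bound mY.aestronglyMeasurable M (Filter.Eventually.of_forall hY)
  · intro B _ _
    exact (Integrable.of_bound mf.aestronglyMeasurable M
      (Filter.Eventually.of_forall fun w => hb w.1)).integrableOn
  · rintro _ ⟨B, hB, rfl⟩ _
    rw [← integral_indicator (measurable_fst hB), ← integral_indicator (measurable_fst hB),
      integral_twoPointLaw hM hf hb (mf.indicator (measurable_fst hB)) (C := M),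
      integral_twoPointLaw hM hf hb (mY.indicator (measurable_fst hB)) (C := M)]
    · congr 1; ext x
      by_cases hx : x ∈ B
      · simp only [Set.indicator, Set.mem_preimage, hx, if_true, topLabel, botLabel]
        field_simp; ring
      · simp [Set.indicator, hx]
    · intro w
      by_cases hx : w ∈ Prod.fst ⁻¹' B
      · simp only [Set.indicator_of_mem hx]; exact hY w
      · simp only [Set.indicator_of_notMem hx]; simpa using hM.le
    · intro w
      by_cases hx : w ∈ Prod.fst ⁻¹' B
      · simp only [Set.indicator_of_mem hx]; exact hb w.1
      · simp only [Set.indicator_of_notMem hx]; simpa using hM.le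
  · exact (hf.comp (comap_measurable _)).stronglyMeasurable.aestronglyMeasurable

theorem inClass_twoPointLaw (hM : 0 < M) {α cL cLow cUp : ℝ} (hcLow : cLow ≤ 1) (hcUp : 1 ≤ cUp)
    {f : Cube d → ℝ} (hf : Measurable f) (hb : ∀ x, |f x| ≤ M) (hh : IsHolder α cL f) :
    InClass α cL cLow cUp (twoPointLaw hM f) where
  isProbabilityMeasure := isProbabilityMeasure_twoPointLaw hM hf hb
  density := ⟨fun _ => 1, measurable_const, fun _ => ⟨hcLow, hcUp⟩, by
    rw [map_fst_twoPointLaw hM hf hb]; simp⟩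
  holder := ⟨f, isRegressionFunction_twoPointLaw hM hf hb, hh⟩

/-- Bias-variance decomposition: the squared label is always M², so the conditional variance is M² -
f x ^ 2. -/
theorem leastSquaresRisk_twoPointLaw (hM : 0 < M) {f : Cube d → ℝ} (hf : Measurable f)
    (hb : ∀ x, |f x| ≤ M) {g : Cube d → ℝ} (hg : Measurable g) :
    leastSquaresRisk (twoPointLaw hM f) g =
      (∫⁻ x, ENNReal.ofReal ((g x - f x) ^ 2)) + ∫⁻ x, ENNReal.ofReal (M ^ 2 - f x ^ 2) := by
  rw [leastSquaresRisk, lintegral_twoPointLaw hM hf (by fun_prop), ← lintegral_add_left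
    (by fun_prop)]
  congr 1; ext x
  have hp := abs_div_le_one hM hb x
  have h2 : f x ^ 2 ≤ M ^ 2 := sq_le_sq' (abs_le.mp (hb x)).1 (abs_le.mp (hb x)).2
  rw [← ENNReal.ofReal_mul (by linarith), ← ENNReal.ofReal_mul (by linarith),
    ← ENNReal.ofReal_add, ← ENNReal.ofReal_add (by positivity) (by linarith)]
  · congr 1
    simp only [topLabel, botLabel]
    field_simp; ring
  · exact mul_nonneg (by linarith) (by positivity)
  · exact mul_nonneg (by linarith) (by positivity)

/-- An upper bound on the Bayes risk is enough here, and f itself is the competitor. The noise term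
is finite, so it cancels in the truncated subtraction. -/
theorem le_excessRisk_twoPointLaw (hM : 0 < M) {f : Cube d → ℝ} (hf : Measurable f)
    (hb : ∀ x, |f x| ≤ M) {g : Cube d → ℝ} (hg : Measurable g) :
    ∫⁻ x, ENNReal.ofReal ((g x - f x) ^ 2) ≤ excessRisk (twoPointLaw hM f) g := by
  have hB : bayesLeastSquaresRisk (twoPointLaw hM f) ≤ ∫⁻ x, ENNReal.ofReal (M ^ 2 - f x ^ 2) := by
    refine (iInf₂_le f hf).trans ?_
    rw [leastSquaresRisk_twoPointLaw hM hf hb hf]; simp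
  have hfin : ∫⁻ x, ENNReal.ofReal (M ^ 2 - f x ^ 2) ≠ ∞ := by
    refine ne_top_of_le_ne_top (b := ∫⁻ _ : Cube d, ENNReal.ofReal (M ^ 2)) (by simp)
      (lintegral_mono fun x => ENNReal.ofReal_le_ofReal (by nlinarith [sq_nonneg (f x)]))
  rw [excessRisk]
  refine le_trans ?_ (tsub_le_tsub_left hB _)
  rw [leastSquaresRisk_twoPointLaw hM hf hb hg, ENNReal.add_sub_cancel_right hfin]

end TwoPointLaw

/-! ### Cauchy-Schwarz on boxes and the gain from private coordinates -/

theorem sq_setLIntegral_le {Ω : Type*} [MeasurableSpace Ω] (μ : Measure Ω) (B : Set Ω)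
    {f : Ω → ℝ≥0∞} (hf : Measurable f) : (∫⁻ x in B, f x ∂μ) ^ 2 ≤ μ B * ∫⁻ x, f x ^ 2 ∂μ := by
  have h := ENNReal.lintegral_mul_le_Lp_mul_Lq (μ.restrict B) Real.HolderConjugate.two_two
    (f := fun _ => 1) (g := f) aemeasurable_const hf.aemeasurable
  simp only [Pi.mul_apply, one_mul, ENNReal.rpow_two, one_pow, lintegral_one,
    Measure.restrict_apply_univ] at h
  calc (∫⁻ x in B, f x ∂μ) ^ 2
      ≤ (μ B ^ (1 / 2 : ℝ) * (∫⁻ x in B, f x ^ 2 ∂μ) ^ (1 / 2 : ℝ)) ^ 2 := by gcongr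
    _ = μ B * ∫⁻ x in B, f x ^ 2 ∂μ := by
        rw [mul_pow, ← ENNReal.rpow_natCast, ← ENNReal.rpow_natCast, ← ENNReal.rpow_mul,
          ← ENNReal.rpow_mul]
        norm_num
    _ ≤ _ := mul_le_mul' le_rfl (setLIntegral_le_lintegral _ _)

theorem sq_lintegral_le {Ω : Type*} [MeasurableSpace Ω] (μ : Measure Ω) [IsProbabilityMeasure μ]
    {f : Ω → ℝ≥0∞} (hf : Measurable f) : (∫⁻ x, f x ∂μ) ^ 2 ≤ ∫⁻ x, f x ^ 2 ∂μ := by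
  simpa using sq_setLIntegral_le μ Set.univ hf

theorem volume_pi_le_pow {ι : Type*} [Fintype ι] {I : ι → Set unitInterval} {v : ℝ≥0∞}
    (hI : ∀ i, volume (I i) ≤ v) : volume (Set.univ.pi I) ≤ v ^ Fintype.card ι := by
  rw [volume_pi_pi]
  exact (Finset.prod_le_prod' fun i _ => hI i).trans (by simp)

/-- If `E` is dominated by `H` along the fibres of the first `s` coordinates, then its integral over
a box gains the volume of the box in these coordinates. -/
theorem sq_setLIntegral_box_le {d s : ℕ} (hs : s ≤ d) {E H : Cube d → ℝ≥0∞} (hE : Measurable E)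
    (hH : Measurable H) (hEH : ∀ x x' : Cube d, (∀ ℓ : Fin d, ¬ (ℓ : ℕ) < s → x ℓ = x' ℓ) → E x ≤ H x')
    {I : Fin d → Set unitInterval} (hIm : ∀ ℓ, MeasurableSet (I ℓ)) {v : ℝ≥0∞}
    (hI : ∀ ℓ, volume (I ℓ) ≤ v) :
    (∫⁻ x in Set.univ.pi I, E x) ^ 2 ≤ v ^ (d + s) * ∫⁻ x, H x ^ 2 := by
  classical
  let e := MeasurableEquiv.piEquivPiSubtypeProd (fun _ : Fin d => unitInterval) (fun ℓ => (ℓ : ℕ) < s)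
  have he : MeasurePreserving e.symm :=
    (volume_preserving_piEquivPiSubtypeProd (fun _ : Fin d => unitInterval)
      (fun ℓ => (ℓ : ℕ) < s)).symm e
  let A : Set ({ℓ : Fin d // (ℓ : ℕ) < s} → unitInterval) := Set.univ.pi fun ℓ => I ℓ
  let B : Set ({ℓ : Fin d // ¬ (ℓ : ℕ) < s} → unitInterval) := Set.univ.pi fun ℓ => I ℓ
  have hA : MeasurableSet A := MeasurableSet.univ_pi fun ℓ => hIm ℓ
  have hB : MeasurableSet B := MeasurableSet.univ_pi fun ℓ => hIm ℓ
  have cA : Fintype.card {ℓ : Fin d // (ℓ : ℕ) < s} = s := by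
    rw [Fintype.card_subtype, Fin.card_filter_val_lt, min_eq_right hs]
  have cB : Fintype.card {ℓ : Fin d // ¬ (ℓ : ℕ) < s} = d - s := by
    rw [Fintype.card_subtype_compl, cA, Fintype.card_fin]
  have vA : volume A ≤ v ^ s := by simpa only [cA] using volume_pi_le_pow (I := fun ℓ : {ℓ : Fin d // (ℓ : ℕ) < s} => I ℓ) fun ℓ => hI ℓ
  have vB : volume B ≤ v ^ (d - s) := by
    simpa only [cB] using volume_pi_le_pow (I := fun ℓ : {ℓ : Fin d // ¬ (ℓ : ℕ) < s} => I ℓ) fun ℓ => hI ℓ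
  have hpre : e.symm ⁻¹' Set.univ.pi I = A ×ˢ B := by
    ext ⟨a, b⟩
    simp only [Set.mem_preimage, Set.mem_univ_pi, Set.mem_prod, A, B, e]
    constructor
    · intro h
      refine ⟨fun ℓ => ?_, fun ℓ => ?_⟩
      · simpa [MeasurableEquiv.piEquivPiSubtypeProd, Equiv.piEquivPiSubtypeProd, ℓ.2] using h ℓ
      · simpa [MeasurableEquiv.piEquivPiSubtypeProd, Equiv.piEquivPiSubtypeProd, ℓ.2] using h ℓ
    · rintro ⟨h1, h2⟩ ℓ
      by_cases hℓ : (ℓ : ℕ) < s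
      · simpa [MeasurableEquiv.piEquivPiSubtypeProd, Equiv.piEquivPiSubtypeProd, hℓ] using h1 ⟨ℓ, hℓ⟩
      · simpa [MeasurableEquiv.piEquivPiSubtypeProd, Equiv.piEquivPiSubtypeProd, hℓ] using h2 ⟨ℓ, hℓ⟩
  -- In the splitting, a holds the first s coordinates and b the others; the domination holds for
  -- arbitrary pairs a, a'.
  have hfib : ∀ a a' b, E (e.symm (a, b)) ≤ H (e.symm (a', b)) := by
    intro a a' b
    refine hEH _ _ fun ℓ hℓ => ?_
    simp [e, MeasurableEquiv.piEquivPiSubtypeProd, Equiv.piEquivPiSubtypeProd, hℓ]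
  have mE : Measurable fun p => E (e.symm p) := hE.comp e.symm.measurable
  have mH : Measurable fun p => H (e.symm p) := hH.comp e.symm.measurable
  let Hb : ({ℓ : Fin d // ¬ (ℓ : ℕ) < s} → unitInterval) → ℝ≥0∞ := fun b => ∫⁻ a, H (e.symm (a, b))
  have mHb : Measurable Hb := mH.lintegral_prod_left'
  -- The fibre has total volume 1, so averaging `hfib` over a' gives E ≤ `Hb` b. This bound is free
  -- of a, so integrating over A costs the full volume of A.
  have h1 : ∫⁻ x in Set.univ.pi I, E x ≤ v ^ s * ∫⁻ b in B, Hb b := by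
    rw [← he.setLIntegral_comp_preimage (MeasurableSet.univ_pi hIm) hE, hpre, Measure.volume_eq_prod,
      ← Measure.prod_restrict, lintegral_prod_symm _ mE.aemeasurable, ← lintegral_const_mul _ mHb]
    refine lintegral_mono fun b => ?_
    calc ∫⁻ a in A, E (e.symm (a, b)) ≤ ∫⁻ _ in A, Hb b := by
          refine lintegral_mono fun a => ?_
          calc E (e.symm (a, b)) = ∫⁻ _ : {ℓ : Fin d // (ℓ : ℕ) < s} → unitInterval,
                E (e.symm (a, b)) := by simp
            _ ≤ Hb b := lintegral_mono fun a' => hfib a a' b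
      _ = Hb b * volume A := by simp
      _ ≤ v ^ s * Hb b := by rw [mul_comm]; gcongr
  have h2 : ∫⁻ b, Hb b ^ 2 ≤ ∫⁻ x, H x ^ 2 := by
    rw [← he.lintegral_comp (hH.pow_const 2), Measure.volume_eq_prod,
      lintegral_prod_symm _ (mH.pow_const 2).aemeasurable]
    exact lintegral_mono fun b => sq_lintegral_le _ (mH.comp (by fun_prop))
  -- The exponent is 2 s from the first coordinates and d - s from Cauchy-Schwarz over B, which sum
  -- to d + s.
  calc (∫⁻ x in Set.univ.pi I, E x) ^ 2 ≤ (v ^ s * ∫⁻ b in B, Hb b) ^ 2 := by gcongr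
    _ = (v ^ s) ^ 2 * (∫⁻ b in B, Hb b) ^ 2 := mul_pow _ _ _
    _ ≤ (v ^ s) ^ 2 * (v ^ (d - s) * ∫⁻ x, H x ^ 2) := by
        gcongr
        exact (sq_setLIntegral_le _ _ mHb).trans (by gcongr)
    _ = v ^ (d + s) * ∫⁻ x, H x ^ 2 := by
        rw [← mul_assoc, ← pow_mul, ← pow_add]
        congr 2; omega

/-! ### χ² bounds through test functions -/

/-- The variational form of the bound `χ²(Q₁, Q₀) + 1 ≤ K`, for test functions with values
in `[0, 1]`. -/
def ChiSqBound {Ω : Type*} [MeasurableSpace Ω] (K : ℝ≥0∞) (Q₁ Q₀ : Measure Ω) : Prop :=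
  ∀ g : Ω → ℝ≥0∞, Measurable g → (∀ x, g x ≤ 1) → (∫⁻ x, g x ∂Q₁) ^ 2 ≤ K * ∫⁻ x, g x ^ 2 ∂Q₀

/-- Apply the hypothesis to g minus its Q₀-mean c: the shift t of the mean satisfies t² ≤ δ Var(g).
A weighted AM-GM inequality then bounds (c + t)² by (1 + δ)(c² + Var(g)). -/
theorem chiSqBound_of_sq_integral_sub_le {Ω : Type*} [MeasurableSpace Ω] {Q₁ Q₀ : Measure Ω}
    [IsProbabilityMeasure Q₁] [IsProbabilityMeasure Q₀] {δ : ℝ} (hδ : 0 ≤ δ)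
    (h : ∀ (g : Ω → ℝ) (C : ℝ), Measurable g → (∀ x, |g x| ≤ C) →
      (∫ x, g x ∂Q₁ - ∫ x, g x ∂Q₀) ^ 2 ≤ δ * ∫ x, g x ^ 2 ∂Q₀) :
    ChiSqBound (ENNReal.ofReal (1 + δ)) Q₁ Q₀ := by
  intro g hg hg1
  have hfin : ∀ x, g x ≠ ∞ := fun x => ne_top_of_le_ne_top ENNReal.one_ne_top (hg1 x)
  obtain ⟨f, rfl⟩ : ∃ f : Ω → ℝ, g = fun x => ENNReal.ofReal (f x) :=
    ⟨fun x => (g x).toReal, by ext x; exact (ENNReal.ofReal_toReal (hfin x)).symm⟩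
  set k : Ω → ℝ := fun x => (ENNReal.ofReal (f x)).toReal
  have mk : Measurable k := hg.ennreal_toReal
  have k0 : ∀ x, 0 ≤ k x := fun x => ENNReal.toReal_nonneg
  have k1 : ∀ x, k x ≤ 1 := fun x => by
    have := ENNReal.toReal_mono ENNReal.one_ne_top (hg1 x); simpa using this
  have hgk : ∀ x, ENNReal.ofReal (f x) = ENNReal.ofReal (k x) := fun x =>
    (ENNReal.ofReal_toReal (hfin x)).symm
  have ik : ∀ (Q : Measure Ω) [IsProbabilityMeasure Q], Integrable k Q := fun Q _ =>
    Integrable.of_bound mk.aestronglyMeasurable 1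
      (Filter.Eventually.of_forall fun x => by rw [Real.norm_eq_abs, abs_of_nonneg (k0 x)]; exact k1 x)
  have ik2 : Integrable (fun x => k x ^ 2) Q₀ := Integrable.of_bound
    (mk.pow_const 2).aestronglyMeasurable 1
      (Filter.Eventually.of_forall fun x => by
        rw [Real.norm_eq_abs, abs_of_nonneg (by positivity)]; nlinarith [k0 x, k1 x])
  simp only [hgk, ← ENNReal.ofReal_pow (k0 _)]
  rw [← ofReal_integral_eq_lintegral_ofReal (ik Q₁) (Filter.Eventually.of_forall k0),
    ← ofReal_integral_eq_lintegral_ofReal ik2 (Filter.Eventually.of_forall fun x => by positivity),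
    ← ENNReal.ofReal_pow (integral_nonneg k0), ← ENNReal.ofReal_mul (by positivity)]
  apply ENNReal.ofReal_le_ofReal
  set c := ∫ x, k x ∂Q₀
  have hc := h (fun x => k x - c) (1 + |c|) (mk.sub_const c) fun x => by
    refine (abs_sub _ _).trans ?_
    rw [abs_of_nonneg (k0 x)]; gcongr; exact k1 x
  have e1 : ∫ x, (k x - c) ∂Q₁ = ∫ x, k x ∂Q₁ - c := by
    rw [integral_sub (ik Q₁) (integrable_const _)]; simp
  have e0 : ∫ x, (k x - c) ∂Q₀ = 0 := by
    rw [integral_sub (ik Q₀) (integrable_const _)]; simp [c]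
  have e2 : ∫ x, (k x - c) ^ 2 ∂Q₀ = ∫ x, k x ^ 2 ∂Q₀ - c ^ 2 := by
    have : ∀ x, (k x - c) ^ 2 = k x ^ 2 - (2 * c * k x - c ^ 2) := fun x => by ring
    simp_rw [this]
    have i3 : Integrable (fun x => 2 * c * k x - c ^ 2) Q₀ :=
      ((ik Q₀).const_mul _).sub (integrable_const _)
    rw [integral_sub ik2 i3, integral_sub ((ik Q₀).const_mul _) (integrable_const _), integral_const_mul]
    simp only [integral_const, probReal_univ, smul_eq_mul, one_mul]
    change _ - (2 * c * c - c ^ 2) = _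
    ring
  rw [e1, e0, e2, sub_zero] at hc
  generalize ∫ x, k x ∂Q₁ = a at *
  set V := ∫ x, k x ^ 2 ∂Q₀
  have hV : 0 ≤ V - c ^ 2 := by rw [← e2]; exact integral_nonneg fun x => by positivity
  obtain ⟨t, rfl⟩ : ∃ t, a = c + t := ⟨a - c, by ring⟩
  rw [add_sub_cancel_left] at hc
  -- The weight in AM-GM is δ, so δ = 0 is treated apart; there t = 0.
  rcases eq_or_lt_of_le hδ with rfl | hδ'
  · have : t = 0 := by nlinarith
    rw [this]; nlinarith
  · have h3 : 2 * c * t ≤ δ * c ^ 2 + t ^ 2 / δ := by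
      have : δ * c ^ 2 + t ^ 2 / δ - 2 * c * t = (δ * c - t) ^ 2 / δ := by field_simp; ring
      have := div_nonneg (sq_nonneg (δ * c - t)) hδ
      linarith
    have h4 : t ^ 2 / δ ≤ V - c ^ 2 := by rw [div_le_iff₀ hδ']; linarith
    nlinarith

/-! ### Tensorization along the transcript -/

namespace SeqMechanism
variable {d n : ℕ} {M : ℝ} {S : Type u} [MeasurableSpace S]

theorem measurable_snoc (k : ℕ) : Measurable fun p : (Fin k → S) × S =>
    (Fin.snoc (α := fun _ => S) p.1 p.2 : Fin (k + 1) → S) := by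
  rw [measurable_pi_iff]
  intro i
  refine Fin.lastCases ?_ (fun j => ?_) i
  · simpa using measurable_snd
  · simpa using (by fun_prop : Measurable fun p : (Fin k → S) × S => p.1 j)

theorem measurable_snoc_right {k : ℕ} (z : Fin k → S) :
    Measurable fun y : S => (Fin.snoc (α := fun _ => S) z y : Fin (k + 1) → S) :=
  (measurable_snoc k).comp (by fun_prop : Measurable fun y : S => (z, y))

theorem isProbabilityMeasure_transcriptLaw (R : SeqMechanism d n M S) (P : Measure (Sample d M))
    [IsProbabilityMeasure P] : ∀ (k : ℕ) (hk : k ≤ n), IsProbabilityMeasure (R.transcriptLaw P k hk)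
  | 0, _ => by rw [transcriptLaw]; infer_instance
  | k + 1, h => by
      have := isProbabilityMeasure_transcriptLaw R P k (Nat.le_of_succ_le h)
      have := R.isMarkovKernel ⟨k, h⟩
      rw [transcriptLaw]
      exact Measure.isProbabilityMeasure_map
        ((measurable_snoc k).comp (by fun_prop : Measurable fun
          q : (Sample d M × (Fin k → S)) × S => (q.1.2, q.2))).aemeasurable

/-- A fresh observation is independent of the past, so given the transcript z the next output has
law `sectL z ∘ₘ P`. -/
theorem lintegral_transcriptLaw_succ (R : SeqMechanism d n M S) (P : Measure (Sample d M))
    [IsProbabilityMeasure P] (k : ℕ) (h : k + 1 ≤ n) {g : (Fin (k + 1) → S) → ℝ≥0∞}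
    (hg : Measurable g) :
    ∫⁻ z, g z ∂(R.transcriptLaw P (k + 1) h) =
      ∫⁻ z, ∫⁻ y, g (Fin.snoc (α := fun _ => S) z y)
        ∂(((R.kernel ⟨k, h⟩).sectL z) ∘ₘ P) ∂(R.transcriptLaw P k (Nat.le_of_succ_le h)) := by
  have := isProbabilityMeasure_transcriptLaw R P k (Nat.le_of_succ_le h)
  have := R.isMarkovKernel ⟨k, h⟩
  have ms : Measurable fun q : (Sample d M × (Fin k → S)) × S =>
      (Fin.snoc (α := fun _ => S) q.1.2 q.2 : Fin (k + 1) → S) :=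
    (measurable_snoc k).comp (by fun_prop : Measurable fun
          q : (Sample d M × (Fin k → S)) × S => (q.1.2, q.2))
  have mg : Measurable fun q : (Sample d M × (Fin k → S)) × S =>
      g (Fin.snoc (α := fun _ => S) q.1.2 q.2) := hg.comp ms
  rw [transcriptLaw, lintegral_map hg ms, Measure.lintegral_compProd mg,
    lintegral_prod_symm _ (Measurable.lintegral_kernel_prod_right' (κ := R.kernel ⟨k, h⟩) mg).aemeasurable]
  congr 1; ext z
  rw [Measure.lintegral_bind (Kernel.aemeasurable _) (f := fun y => g (Fin.snoc (α := fun _ => S) z y))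
    (hg.comp (measurable_snoc_right z)).aemeasurable]
  rfl

/-- Integrating out the last output under P₁ leaves a [0, 1]-valued test function of the earlier
ones. The induction hypothesis applies to it, and the one-step bound, which is uniform in z,
controls its square. -/
theorem chiSqBound_transcriptLaw (R : SeqMechanism d n M S) {P₁ P₀ : Measure (Sample d M)}
    [IsProbabilityMeasure P₁] [IsProbabilityMeasure P₀] {K : ℝ≥0∞} (hK : K ≠ ∞)
    (h : ∀ (i : Fin n) (z : Fin i → S),
      ChiSqBound K ((R.kernel i).sectL z ∘ₘ P₁) ((R.kernel i).sectL z ∘ₘ P₀)) :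
    ∀ (k : ℕ) (hk : k ≤ n), ChiSqBound (K ^ k) (R.transcriptLaw P₁ k hk) (R.transcriptLaw P₀ k hk)
  | 0, _ => by
      intro g hg _
      rw [transcriptLaw, transcriptLaw, lintegral_dirac' _ hg, lintegral_dirac' _ (hg.pow_const 2)]
      simp
  | k + 1, hk => by
      intro g hg hg1
      have ih := chiSqBound_transcriptLaw R hK h k (Nat.le_of_succ_le hk)
      have hM := R.isMarkovKernel ⟨k, hk⟩
      rw [lintegral_transcriptLaw_succ R P₁ k hk hg,
        lintegral_transcriptLaw_succ R P₀ k hk (hg.pow_const 2)]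
      have mg : Measurable fun q : (Sample d M × (Fin k → S)) × S =>
          g (Fin.snoc (α := fun _ => S) q.1.2 q.2) :=
        hg.comp ((measurable_snoc k).comp (by fun_prop : Measurable fun
          q : (Sample d M × (Fin k → S)) × S => (q.1.2, q.2)))
      have mz : ∀ z : Fin k → S, Measurable fun y => g (Fin.snoc (α := fun _ => S) z y) :=
        fun z => hg.comp (measurable_snoc_right z)
      have mG : Measurable fun z : Fin k → S => ∫⁻ y, g (Fin.snoc (α := fun _ => S) z y)
          ∂(((R.kernel ⟨k, hk⟩).sectL z) ∘ₘ P₁) := by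
        have := (Measurable.lintegral_kernel_prod_right' (κ := R.kernel ⟨k, hk⟩)
          mg).lintegral_prod_left' (μ := P₁)
        convert this using 2 with z
        rw [Measure.lintegral_bind (Kernel.aemeasurable _) (mz z).aemeasurable]
        rfl
      refine (ih _ mG fun z => ?_).trans ?_
      · have : ∫⁻ _ : S, (1 : ℝ≥0∞) ∂(((R.kernel ⟨k, hk⟩).sectL z) ∘ₘ P₁) = 1 := by simp
        exact (lintegral_mono fun y => hg1 _).trans this.le
      · rw [pow_succ, mul_assoc, ← lintegral_const_mul' _ _ hK]
        exact mul_le_mul' le_rfl (lintegral_mono fun z => h ⟨k, hk⟩ z _ (mz z) fun y => hg1 _)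

end SeqMechanism

/-! ### Label sensitivity and the χ² cost of one output -/

section LabelSensitivity

variable {d : ℕ} {M : ℝ} {S : Type u} [MeasurableSpace S]

/-- The effect of flipping the label on the output of `κ` is at most `k` times the mass of the
output, also after the first `s` features have been changed. -/
def LabelSensitive (hM : 0 < M) (κ : Kernel (Sample d M) S) (s : ℕ) (k : ℝ) : Prop :=
  ∀ (g : S → ℝ) (C : ℝ), Measurable g → (∀ y, |g y| ≤ C) →
    ∀ x x' : Cube d, (∀ ℓ : Fin d, ¬ (ℓ : ℕ) < s → x ℓ = x' ℓ) →
      |∫ y, g y ∂κ (x, topLabel hM) - ∫ y, g y ∂κ (x, botLabel hM)| ≤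
        k * (∫ y, |g y| ∂κ (x', topLabel hM) + ∫ y, |g y| ∂κ (x', botLabel hM))

/-- With s = 0 the points x and x' coincide and the triangle inequality suffices. No privacy is
involved; this is the source of the non-private rate. -/
theorem labelSensitive_zero_one (hM : 0 < M) (κ : Kernel (Sample d M) S) :
    LabelSensitive hM κ 0 1 := by
  intro g C hg hC x x' hx
  obtain rfl : x = x' := funext fun ℓ => hx ℓ (by simp)
  rw [one_mul]
  exact (abs_sub _ _).trans (add_le_add abs_integral_le_integral_abs abs_integral_le_integral_abs)

theorem integral_le_mul_integral_of_measure_le {Ω : Type*} [MeasurableSpace Ω] {μ ν : Measure Ω}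
    [IsProbabilityMeasure ν] {c : ℝ} (hc : 0 ≤ c) (h : ∀ A, MeasurableSet A → μ A ≤ ENNReal.ofReal c * ν A)
    {g : Ω → ℝ} {C : ℝ} (hg : Measurable g) (hC : ∀ y, |g y| ≤ C) (h0 : ∀ y, 0 ≤ g y) :
    ∫ y, g y ∂μ ≤ c * ∫ y, g y ∂ν := by
  have hle : μ ≤ ENNReal.ofReal c • ν := Measure.le_iff.mpr fun A hA => by simpa using h A hA
  have hi : Integrable g ν := Integrable.of_bound hg.aestronglyMeasurable C
    (Filter.Eventually.of_forall hC)
  have := integral_mono_measure hle (Filter.Eventually.of_forall h0)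
    (hi.smul_measure ENNReal.ofReal_ne_top)
  rwa [integral_smul_measure, ENNReal.toReal_ofReal hc, smul_eq_mul] at this

/-- Two probability measures with likelihood ratios in `[1 / c, c]` integrate `g` within
`c - 1` times the mass of `|g|`. -/
theorem abs_integral_sub_integral_le {Ω : Type*} [MeasurableSpace Ω] {μ ν : Measure Ω}
    [IsProbabilityMeasure μ] [IsProbabilityMeasure ν] {c : ℝ} (hc : 1 ≤ c)
    (h : ∀ A, MeasurableSet A → μ A ≤ ENNReal.ofReal c * ν A)
    (h' : ∀ A, MeasurableSet A → ν A ≤ ENNReal.ofReal c * μ A)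
    {g : Ω → ℝ} {C : ℝ} (hg : Measurable g) (hC : ∀ y, |g y| ≤ C) :
    |∫ y, g y ∂μ - ∫ y, g y ∂ν| ≤ (c - 1) * ∫ y, |g y| ∂ν := by
  have bp : ∀ y, |max (g y) 0| ≤ C := fun y =>
    (abs_le.mpr ⟨by linarith [le_max_right (g y) 0, abs_nonneg (g y)],
      max_le (le_abs_self _) (abs_nonneg _)⟩).trans (hC y)
  have bm : ∀ y, |max (-g y) 0| ≤ C := fun y =>
    (abs_le.mpr ⟨by linarith [le_max_right (-g y) 0, abs_nonneg (g y)],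
      max_le (neg_le_abs _) (abs_nonneg _)⟩).trans (hC y)
  have mp : Measurable fun y => max (g y) 0 := by fun_prop
  have mm : Measurable fun y => max (-g y) 0 := by fun_prop
  have ip : ∀ (Q : Measure Ω) [IsProbabilityMeasure Q], Integrable (fun y => max (g y) 0) Q :=
    fun Q _ => Integrable.of_bound mp.aestronglyMeasurable C (Filter.Eventually.of_forall bp)
  have im : ∀ (Q : Measure Ω) [IsProbabilityMeasure Q], Integrable (fun y => max (-g y) 0) Q :=
    fun Q _ => Integrable.of_bound mm.aestronglyMeasurable C (Filter.Eventually.of_forall bm)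
  have e1 : ∀ (Q : Measure Ω) [IsProbabilityMeasure Q],
      ∫ y, g y ∂Q = ∫ y, max (g y) 0 ∂Q - ∫ y, max (-g y) 0 ∂Q := fun Q _ => by
    rw [← integral_sub (ip Q) (im Q)]
    congr 1; ext y
    rcases le_total 0 (g y) with hy | hy
    · rw [max_eq_left hy, max_eq_right (by linarith)]; ring
    · rw [max_eq_right hy, max_eq_left (by linarith)]; ring
  have e2 : ∫ y, |g y| ∂ν = ∫ y, max (g y) 0 ∂ν + ∫ y, max (-g y) 0 ∂ν := by
    rw [← integral_add (ip ν) (im ν)]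
    congr 1; ext y
    rcases le_total 0 (g y) with hy | hy
    · rw [max_eq_left hy, max_eq_right (by linarith), abs_of_nonneg hy]; ring
    · rw [max_eq_right hy, max_eq_left (by linarith), abs_of_nonpos hy]; ring
  have hc0 : 0 ≤ c := by linarith
  have p1 := integral_le_mul_integral_of_measure_le hc0 h mp bp (fun y => le_max_right _ _)
  have p2 := integral_le_mul_integral_of_measure_le hc0 h' mp bp (fun y => le_max_right _ _)
  have m1 := integral_le_mul_integral_of_measure_le hc0 h mm bm (fun y => le_max_right _ _)
  have m2 := integral_le_mul_integral_of_measure_le hc0 h' mm bm (fun y => le_max_right _ _)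
  have n1 : 0 ≤ ∫ y, max (g y) 0 ∂ν := integral_nonneg fun y => le_max_right _ _
  have n2 : 0 ≤ ∫ y, max (-g y) 0 ∂ν := integral_nonneg fun y => le_max_right _ _
  rw [e1 μ, e1 ν, e2]
  generalize ∫ y, max (g y) 0 ∂μ = a at *
  generalize ∫ y, max (g y) 0 ∂ν = b at *
  generalize ∫ y, max (-g y) 0 ∂μ = a' at *
  generalize ∫ y, max (-g y) 0 ∂ν = b' at *
  -- The lower side uses a ≥ b / c ≥ (2 - c) b, the last inequality being (c - 1)² ≥ 0.
  have key : ∀ a b : ℝ, 0 ≤ b → a ≤ c * b → b ≤ c * a → |a - b| ≤ (c - 1) * b := by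
    intro a b hb h1 h2
    rw [abs_le]
    constructor
    · nlinarith [mul_nonneg hb (sq_nonneg (c - 1)), mul_nonneg hb (sub_nonneg.mpr hc)]
    · linarith
  calc |a - a' - (b - b')| = |(a - b) - (a' - b')| := by congr 1; ring
    _ ≤ |a - b| + |a' - b'| := abs_sub _ _
    _ ≤ (c - 1) * (b + b') := by linarith [key a b n1 p1 p2, key a' b' n2 m1 m2]

/-- Both outputs at x are compared with the same output at x'. The reference label T gives 2 (c - 1)
times its mass, and so does the reference L; averaging the two bounds removes the factor 2. -/
theorem labelSensitive_of_ratio_le (hM : 0 < M) (κ : Kernel (Sample d M) S) [IsMarkovKernel κ]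
    {s : ℕ} {c : ℝ} (hc : 1 ≤ c)
    (h : ∀ A, MeasurableSet A → ∀ x x' : Cube d, (∀ ℓ : Fin d, ¬ (ℓ : ℕ) < s → x ℓ = x' ℓ) →
      ∀ y y' : Label M, κ (x, y) A ≤ ENNReal.ofReal c * κ (x', y') A) :
    LabelSensitive hM κ s (c - 1) := by
  intro g C hg hC x x' hx
  have key : ∀ y y' : Label M, |∫ z, g z ∂κ (x, y) - ∫ z, g z ∂κ (x', y')| ≤
      (c - 1) * ∫ z, |g z| ∂κ (x', y') := fun y y' =>
    abs_integral_sub_integral_le hc (fun A hA => h A hA x x' hx y y')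
      (fun A hA => h A hA x' x (fun ℓ hℓ => (hx ℓ hℓ).symm) y' y) hg hC
  have k1 := abs_le.mp (key (topLabel hM) (topLabel hM))
  have k2 := abs_le.mp (key (topLabel hM) (botLabel hM))
  have k3 := abs_le.mp (key (botLabel hM) (topLabel hM))
  have k4 := abs_le.mp (key (botLabel hM) (botLabel hM))
  rw [abs_le]
  constructor <;> linarith [k1.1, k1.2, k2.1, k2.2, k3.1, k3.2, k4.1, k4.2]

theorem integral_comp_measure {Ω Ω' : Type*} [MeasurableSpace Ω] [MeasurableSpace Ω']
    {μ : Measure Ω} {κ : Kernel Ω Ω'} {g : Ω' → ℝ} (hg : Integrable g (κ ∘ₘ μ)) :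
    ∫ y, g y ∂(κ ∘ₘ μ) = ∫ x, ∫ y, g y ∂κ x ∂μ := by
  rw [Measure.comp_eq_comp_const_apply] at hg ⊢
  rw [Kernel.integral_comp hg, Kernel.const_apply]

/-- The heart of the argument: the change of mean is an integral over the box of the label effect E,
which label sensitivity dominates by H along private fibres. `sq_setLIntegral_box_le` gives the
factor v ^ (d + s), and Jensen's inequality turns the second moment of H into that of g under the
output law. -/
theorem sq_integral_sub_integral_le (hM : 0 < M) (κ : Kernel (Sample d M) S) [IsMarkovKernel κ]
    {s : ℕ} (hs : s ≤ d) {k : ℝ} (hk : 0 ≤ k) (hκ : LabelSensitive hM κ s k)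
    {f₁ f₀ : Cube d → ℝ} (m₁ : Measurable f₁) (m₀ : Measurable f₀)
    (b₁ : ∀ x, |f₁ x| ≤ M / 2) (b₀ : ∀ x, |f₀ x| ≤ M / 2)
    {I : Fin d → Set unitInterval} (hIm : ∀ ℓ, MeasurableSet (I ℓ)) {v : ℝ} (hv : 0 ≤ v)
    (hI : ∀ ℓ, volume (I ℓ) ≤ ENNReal.ofReal v) {b : ℝ} (hb : 0 ≤ b)
    (hf : ∀ x, |f₁ x - f₀ x| ≤ M * b) (hsupp : ∀ x, x ∉ Set.univ.pi I → f₁ x = f₀ x)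
    {g : S → ℝ} {C : ℝ} (hg : Measurable g) (hC : ∀ y, |g y| ≤ C) :
    (∫ y, g y ∂(κ ∘ₘ twoPointLaw hM f₁) - ∫ y, g y ∂(κ ∘ₘ twoPointLaw hM f₀)) ^ 2 ≤
      2 * b ^ 2 * k ^ 2 * v ^ (d + s) * ∫ y, g y ^ 2 ∂(κ ∘ₘ twoPointLaw hM f₀) := by
  have B₁ : ∀ x, |f₁ x| ≤ M := fun x => (b₁ x).trans (by linarith)
  have B₀ : ∀ x, |f₀ x| ≤ M := fun x => (b₀ x).trans (by linarith)
  have := isProbabilityMeasure_twoPointLaw hM m₁ B₁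
  have := isProbabilityMeasure_twoPointLaw hM m₀ B₀
  have ig : ∀ (Q : Measure S) [IsProbabilityMeasure Q], Integrable g Q := fun Q _ =>
    Integrable.of_bound hg.aestronglyMeasurable C (Filter.Eventually.of_forall hC)
  set T := topLabel hM
  set L := botLabel hM
  let G : Sample d M → ℝ := fun w => ∫ y, g y ∂κ w
  have mG : Measurable G := (hg.stronglyMeasurable.integral_kernel (κ := κ)).measurable
  have bG : ∀ w, |G w| ≤ C := fun w => by
    have := norm_integral_le_of_norm_le_const (μ := κ w) 
      (Filter.Eventually.of_forall fun y => (Real.norm_eq_abs (g y)).trans_le (hC y))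
    simpa using this
  have mGT : Measurable fun x : Cube d => G (x, T) := mG.comp (by fun_prop)
  have mGL : Measurable fun x : Cube d => G (x, L) := mG.comp (by fun_prop)
  have hdiff : ∫ y, g y ∂(κ ∘ₘ twoPointLaw hM f₁) - ∫ y, g y ∂(κ ∘ₘ twoPointLaw hM f₀) =
      ∫ x, (f₁ x - f₀ x) / (2 * M) * (G (x, T) - G (x, L)) := by
    have hI' : ∀ f : Cube d → ℝ, Measurable f → (∀ x, |f x| ≤ M) → Integrable fun x =>
        (1 + f x / M) / 2 * G (x, T) + (1 - f x / M) / 2 * G (x, L) := by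
      intro f hf hb
      refine Integrable.of_bound (C := C) (by fun_prop) (Filter.Eventually.of_forall fun x => ?_)
      have hp := abs_div_le_one hM hb x
      have h1 := abs_le.mp (bG (x, T))
      have h2 := abs_le.mp (bG (x, L))
      rw [Real.norm_eq_abs, abs_le]
      constructor <;> nlinarith
    rw [integral_comp_measure (ig _), integral_comp_measure (ig _),
      integral_twoPointLaw hM m₁ B₁ mG bG, integral_twoPointLaw hM m₀ B₀ mG bG,
      ← integral_sub (hI' f₁ m₁ B₁) (hI' f₀ m₀ B₀)]
    congr 1; ext x
    field_simp; ring
  let E : Cube d → ℝ≥0∞ := fun x => ‖G (x, T) - G (x, L)‖ₑ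
  have mE : Measurable E := by fun_prop
  let J : Sample d M → ℝ≥0∞ := fun w => ∫⁻ y, ‖g y‖ₑ ∂κ w
  have mJ : Measurable J := hg.enorm.lintegral_kernel
  let H : Cube d → ℝ≥0∞ := fun x => ENNReal.ofReal k * (J (x, T) + J (x, L))
  have mJT : Measurable fun x : Cube d => J (x, T) := mJ.comp (by fun_prop)
  have mJL : Measurable fun x : Cube d => J (x, L) := mJ.comp (by fun_prop)
  have mH : Measurable H := by fun_prop
  have hEH : ∀ x x' : Cube d, (∀ ℓ : Fin d, ¬ (ℓ : ℕ) < s → x ℓ = x' ℓ) → E x ≤ H x' := by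
    intro x x' hx
    have hJ : ∀ w, J w = ENNReal.ofReal (∫ y, |g y| ∂κ w) := fun w =>
      (ofReal_integral_norm_eq_lintegral_enorm (ig (κ w))).symm
    simp only [E, H, hJ]
    rw [← ENNReal.ofReal_add (integral_nonneg fun _ => abs_nonneg _)
      (integral_nonneg fun _ => abs_nonneg _), ← ENNReal.ofReal_mul hk, Real.enorm_eq_ofReal_abs]
    exact ENNReal.ofReal_le_ofReal (hκ g C hg hC x x' hx)
  have hbox := sq_setLIntegral_box_le hs mE mH hEH hIm hI
  have hH : ∫⁻ x, H x ^ 2 ≤ ENNReal.ofReal (8 * k ^ 2) *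
      ∫⁻ y, ENNReal.ofReal (g y ^ 2) ∂(κ ∘ₘ twoPointLaw hM f₀) := by
    have mg2 : Measurable fun y => ENNReal.ofReal (g y ^ 2) := by fun_prop
    let W : Sample d M → ℝ≥0∞ := fun w => ∫⁻ y, ENNReal.ofReal (g y ^ 2) ∂κ w
    have mW : Measurable W := mg2.lintegral_kernel
    have hJW : ∀ w, J w ^ 2 ≤ W w := fun w => by
      refine (sq_lintegral_le (κ w) hg.enorm).trans_eq ?_
      congr 1; ext y
      rw [Real.enorm_eq_ofReal_abs, ← ENNReal.ofReal_pow (abs_nonneg _), sq_abs]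
    rw [Measure.lintegral_bind κ.aemeasurable mg2.aemeasurable, lintegral_twoPointLaw hM m₀ mW,
      ← lintegral_const_mul' _ _ ENNReal.ofReal_ne_top]
    refine lintegral_mono fun x => ?_
    -- Since |f₀| ≤ M / 2, each label has conditional probability at least 1/4, so the output law at
    -- f₀ controls both labels.
    have hp1 : ENNReal.ofReal (1 / 4) ≤ ENNReal.ofReal ((1 + f₀ x / M) / 2) := by
      apply ENNReal.ofReal_le_ofReal
      have := (abs_le.mp (b₀ x)).1
      have : -(1 / 2) ≤ f₀ x / M := by rw [le_div_iff₀ hM]; linarith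
      linarith
    have hp2 : ENNReal.ofReal (1 / 4) ≤ ENNReal.ofReal ((1 - f₀ x / M) / 2) := by
      apply ENNReal.ofReal_le_ofReal
      have := (abs_le.mp (b₀ x)).2
      have : f₀ x / M ≤ 1 / 2 := by rw [div_le_iff₀ hM]; linarith
      linarith
    have h2 : (J (x, T) + J (x, L)) ^ 2 ≤ 2 * (W (x, T) + W (x, L)) := by
      have := ENNReal.rpow_add_le_mul_rpow_add_rpow (J (x, T)) (J (x, L)) (p := 2) (by norm_num)
      norm_num at this
      refine this.trans ?_
      gcongr <;> apply hJW
    calc H x ^ 2 = ENNReal.ofReal k ^ 2 * (J (x, T) + J (x, L)) ^ 2 := mul_pow _ _ _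
      _ ≤ ENNReal.ofReal k ^ 2 * (2 * (W (x, T) + W (x, L))) := by gcongr
      -- Here 8 is the 2 of (a + b)² ≤ 2 (a² + b²) divided by 1/4. With (b / 2)² from `hD` it makes
      -- the final constant 2.
      _ = ENNReal.ofReal (8 * k ^ 2) * (ENNReal.ofReal (1 / 4) * W (x, T) +
            ENNReal.ofReal (1 / 4) * W (x, L)) := by
          rw [← mul_add, ← mul_assoc, ← mul_assoc, ← ENNReal.ofReal_mul (by positivity),
            ← ENNReal.ofReal_pow hk, show (2 : ℝ≥0∞) = ENNReal.ofReal 2 by simp,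
            ← ENNReal.ofReal_mul (by positivity)]
          congr 2; ring
      _ ≤ _ := by gcongr
  have hD : ‖∫ x, (f₁ x - f₀ x) / (2 * M) * (G (x, T) - G (x, L))‖ₑ ≤
      ENNReal.ofReal (b / 2) * ∫⁻ x in Set.univ.pi I, E x := by
    refine (enorm_integral_le_lintegral_enorm _).trans ?_
    rw [← lintegral_const_mul _ mE, ← lintegral_indicator (MeasurableSet.univ_pi hIm)]
    refine lintegral_mono fun x => ?_
    by_cases hx : x ∈ Set.univ.pi I
    · rw [Set.indicator_of_mem hx, enorm_mul]
      gcongr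
      rw [Real.enorm_eq_ofReal_abs]
      apply ENNReal.ofReal_le_ofReal
      rw [abs_div, abs_of_pos (by positivity : 0 < 2 * M), div_le_iff₀ (by positivity)]
      linarith [hf x]
    · simp [hsupp x hx]
  have hg2 : Integrable (fun y => g y ^ 2) (κ ∘ₘ twoPointLaw hM f₀) :=
    Integrable.of_bound (hg.pow_const 2).aestronglyMeasurable (C ^ 2)
      (Filter.Eventually.of_forall fun y => by
        rw [norm_pow]; exact pow_le_pow_left₀ (norm_nonneg _) (hC y) 2)
  have hfinal : ENNReal.ofReal ((∫ x, (f₁ x - f₀ x) / (2 * M) * (G (x, T) - G (x, L))) ^ 2) ≤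
      ENNReal.ofReal (2 * b ^ 2 * k ^ 2 * v ^ (d + s) *
        ∫ y, g y ^ 2 ∂(κ ∘ₘ twoPointLaw hM f₀)) := by
    rw [← sq_abs, ENNReal.ofReal_pow (abs_nonneg _), ← Real.enorm_eq_ofReal_abs,
      ENNReal.ofReal_mul (by positivity),
      ofReal_integral_eq_lintegral_ofReal hg2 (Filter.Eventually.of_forall fun y => by positivity)]
    calc _ ≤ (ENNReal.ofReal (b / 2) * ∫⁻ x in Set.univ.pi I, E x) ^ 2 := by gcongr
      _ = ENNReal.ofReal (b / 2) ^ 2 * (∫⁻ x in Set.univ.pi I, E x) ^ 2 := mul_pow _ _ _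
      _ ≤ ENNReal.ofReal (b / 2) ^ 2 * (ENNReal.ofReal v ^ (d + s) * (ENNReal.ofReal (8 * k ^ 2) *
            ∫⁻ y, ENNReal.ofReal (g y ^ 2) ∂(κ ∘ₘ twoPointLaw hM f₀))) :=
          mul_le_mul' le_rfl (hbox.trans (mul_le_mul' le_rfl hH))
      _ = _ := by
          rw [← mul_assoc, ← mul_assoc, ← ENNReal.ofReal_pow (by positivity),
            ← ENNReal.ofReal_pow hv, ← ENNReal.ofReal_mul (by positivity),
            ← ENNReal.ofReal_mul (by positivity)]
          congr 2; ring
  rw [hdiff]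
  exact (ENNReal.ofReal_le_ofReal_iff (mul_nonneg (by positivity)
    (integral_nonneg fun y => by positivity))).mp hfinal

theorem chiSqBound_comp_twoPointLaw (hM : 0 < M) (κ : Kernel (Sample d M) S) [IsMarkovKernel κ]
    {s : ℕ} (hs : s ≤ d) {k : ℝ} (hk : 0 ≤ k) (hκ : LabelSensitive hM κ s k)
    {f₁ f₀ : Cube d → ℝ} (m₁ : Measurable f₁) (m₀ : Measurable f₀)
    (b₁ : ∀ x, |f₁ x| ≤ M / 2) (b₀ : ∀ x, |f₀ x| ≤ M / 2)
    {I : Fin d → Set unitInterval} (hIm : ∀ ℓ, MeasurableSet (I ℓ)) {v : ℝ} (hv : 0 ≤ v)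
    (hI : ∀ ℓ, volume (I ℓ) ≤ ENNReal.ofReal v) {b : ℝ} (hb : 0 ≤ b)
    (hf : ∀ x, |f₁ x - f₀ x| ≤ M * b) (hsupp : ∀ x, x ∉ Set.univ.pi I → f₁ x = f₀ x) :
    ChiSqBound (ENNReal.ofReal (1 + 2 * b ^ 2 * k ^ 2 * v ^ (d + s)))
      (κ ∘ₘ twoPointLaw hM f₁) (κ ∘ₘ twoPointLaw hM f₀) := by
  have := isProbabilityMeasure_twoPointLaw hM m₁ fun x => (b₁ x).trans (by linarith)
  have := isProbabilityMeasure_twoPointLaw hM m₀ fun x => (b₀ x).trans (by linarith)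
  exact chiSqBound_of_sq_integral_sub_le (by positivity) fun g C hg hC =>
    sq_integral_sub_integral_le hM κ hs hk hκ m₁ m₀ b₁ b₀ hIm hv hI hb hf hsupp hg hC

/-! ### From χ² to testing error -/

/-- Two point testing: if `Q₁` is within a bounded `χ²`-distance of `Q₀`, two losses whose sum is
bounded below cannot both be small in mean. -/
theorem le_add_lintegral_of_chiSqBound {Ω : Type*} [MeasurableSpace Ω] {Q₁ Q₀ : Measure Ω}
    [IsProbabilityMeasure Q₁] {K : ℝ≥0∞} (hK : K ≤ 3)
    (h : ChiSqBound K Q₁ Q₀) {l₀ l₁ : Ω → ℝ≥0∞} (m₁ : Measurable l₁) {Δ : ℝ} (hΔ : 0 ≤ Δ)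
    (hl : ∀ z, ENNReal.ofReal (2 * Δ) ≤ l₀ z + l₁ z) :
    ENNReal.ofReal (Δ / 12) ≤ ∫⁻ z, l₀ z ∂Q₀ + ∫⁻ z, l₁ z ∂Q₁ := by
  -- A is the event that l₁ is small; there l₀ must be at least Δ.
  let A : Set Ω := {z | l₁ z < ENNReal.ofReal Δ}
  have mA : MeasurableSet A := measurableSet_lt m₁ measurable_const
  have hA0 : ∀ z ∈ A, ENNReal.ofReal Δ ≤ l₀ z := by
    intro z hz
    by_contra hc
    push Not at hc
    have := ENNReal.add_lt_add hc hz
    rw [← ENNReal.ofReal_add hΔ hΔ, ← two_mul] at this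
    exact absurd (hl z) (not_le.mpr this)
  have h0 : ENNReal.ofReal Δ * Q₀ A ≤ ∫⁻ z, l₀ z ∂Q₀ := by
    rw [← setLIntegral_const]
    exact (setLIntegral_mono' mA hA0).trans (setLIntegral_le_lintegral _ _)
  have h1 : ENNReal.ofReal Δ * Q₁ Aᶜ ≤ ∫⁻ z, l₁ z ∂Q₁ := by
    rw [← setLIntegral_const]
    exact (setLIntegral_mono' mA.compl fun z hz => not_lt.mp hz).trans (setLIntegral_le_lintegral _ _)
  have hchi : Q₁ A ^ 2 ≤ 3 * Q₀ A := by
    have := h (A.indicator 1) (measurable_one.indicator mA) fun x => by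
      by_cases hx : x ∈ A <;> simp [hx]
    have hsq : ∀ x, (A.indicator 1 x : ℝ≥0∞) ^ 2 = A.indicator 1 x := fun x => by
      by_cases hx : x ∈ A <;> simp [hx]
    simp only [hsq, lintegral_indicator_one mA] at this
    exact this.trans (by gcongr)
  -- Either Q₁ gives the complement of A mass at least 1/2, or Q₀ gives A mass at least (1/2)² / 3 =
  -- 1/12.
  have hmass : ENNReal.ofReal (1 / 12) ≤ Q₀ A + Q₁ Aᶜ := by
    rcases le_total (Q₁ A) (ENNReal.ofReal (1 / 2)) with hh | hh
    · refine le_trans ?_ le_add_self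
      rw [prob_compl_eq_one_sub mA]
      refine le_trans ?_ (tsub_le_tsub_left hh 1)
      rw [← ENNReal.ofReal_one, ← ENNReal.ofReal_sub _ (by norm_num)]
      exact ENNReal.ofReal_le_ofReal (by norm_num)
    · refine le_trans ?_ le_self_add
      have h3 : ENNReal.ofReal (1 / 4) ≤ 3 * Q₀ A := by
        refine le_trans (le_of_eq ?_) ((pow_le_pow_left' hh 2).trans hchi)
        rw [← ENNReal.ofReal_pow (by norm_num)]; norm_num
      have h4 : ENNReal.ofReal (1 / 4) = 3 * ENNReal.ofReal (1 / 12) := by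
        rw [show (3 : ℝ≥0∞) = ENNReal.ofReal 3 by simp, ← ENNReal.ofReal_mul (by norm_num)]
        norm_num
      rw [h4] at h3
      exact (ENNReal.mul_le_mul_iff_right (by norm_num) (by norm_num)).mp h3
  calc ENNReal.ofReal (Δ / 12) = ENNReal.ofReal Δ * ENNReal.ofReal (1 / 12) := by
        rw [← ENNReal.ofReal_mul hΔ]; congr 1; ring
    _ ≤ ENNReal.ofReal Δ * (Q₀ A + Q₁ Aᶜ) := by gcongr
    _ ≤ _ := by rw [mul_add]; exact add_le_add h0 h1

end LabelSensitivity

/-! ### Signed sums of functions with disjoint supports -/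

/-- The sign `±1` of a bit. -/
noncomputable def bitSign (b : Bool) : ℝ := if b then 1 else -1

theorem abs_bitSign (b : Bool) : |bitSign b| = 1 := by cases b <;> simp [bitSign]

theorem bitSign_not (b : Bool) : bitSign (!b) = -bitSign b := by cases b <;> simp [bitSign]

section DisjointSupports

variable {ι X : Type*} [Fintype ι] {Ψ : ι → X → ℝ}

theorem sum_bitSign_eq (σ : ι → Bool) {i : ι} {x : X}
    (hi : ∀ j, j ≠ i → Ψ j x = 0) : ∑ j, bitSign (σ j) * Ψ j x = bitSign (σ i) * Ψ i x :=
  Finset.sum_eq_single i (fun j _ hj => by rw [hi j hj, mul_zero]) (by simp)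

theorem exists_forall_ne_eq_zero [Nonempty ι] (hd : ∀ i j x, i ≠ j → Ψ i x ≠ 0 → Ψ j x = 0) (x : X) :
    ∃ i, ∀ j, j ≠ i → Ψ j x = 0 := by
  by_cases h : ∃ i, Ψ i x ≠ 0
  · obtain ⟨i, hi⟩ := h
    exact ⟨i, fun j hj => hd i j x hj.symm hi⟩
  · push Not at h
    exact ⟨Classical.arbitrary ι, fun j _ => h j⟩

theorem abs_sum_bitSign_le [Nonempty ι] (hd : ∀ i j x, i ≠ j → Ψ i x ≠ 0 → Ψ j x = 0)
    (σ : ι → Bool) {x : X} {B : ℝ} (hB : ∀ i, |Ψ i x| ≤ B) : |∑ j, bitSign (σ j) * Ψ j x| ≤ B := by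
  obtain ⟨i, hi⟩ := exists_forall_ne_eq_zero hd x
  rw [sum_bitSign_eq σ hi, abs_mul, abs_bitSign, one_mul]
  exact hB i

/-- At most one term is active at each point. The factor 2 arises when x and y lie in different
supports: each value is then compared with a zero of the same function. -/
theorem abs_sum_bitSign_sub_le [Nonempty ι] (hd : ∀ i j x, i ≠ j → Ψ i x ≠ 0 → Ψ j x = 0)
    (σ : ι → Bool) {x y : X} {ρ : ℝ} (hρ : ∀ i, |Ψ i x - Ψ i y| ≤ ρ) :
    |∑ j, bitSign (σ j) * Ψ j x - ∑ j, bitSign (σ j) * Ψ j y| ≤ 2 * ρ := by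
  obtain ⟨i, hi⟩ := exists_forall_ne_eq_zero hd x
  obtain ⟨j, hj⟩ := exists_forall_ne_eq_zero hd y
  rw [sum_bitSign_eq σ hi, sum_bitSign_eq σ hj]
  have hρ0 : 0 ≤ ρ := (abs_nonneg _).trans (hρ i)
  by_cases hij : i = j
  · subst hij
    rw [← mul_sub, abs_mul, abs_bitSign, one_mul]
    linarith [hρ i]
  · have h1 := hρ i
    have h2 := hρ j
    rw [hj i hij, sub_zero] at h1
    rw [hi j (Ne.symm hij), zero_sub, abs_neg] at h2
    refine (abs_sub _ _).trans ?_
    rw [abs_mul, abs_mul, abs_bitSign, abs_bitSign]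
    linarith

end DisjointSupports

/-! ### Hölder bumps -/

theorem abs_rpow_sub_rpow_le {α a b : ℝ} (hα₀ : 0 < α) (hα₁ : α ≤ 1) (ha : 0 ≤ a) (hb : 0 ≤ b) :
    |a ^ α - b ^ α| ≤ |a - b| ^ α := by
  wlog h : b ≤ a generalizing a b
  · rw [abs_sub_comm, abs_sub_comm a b]; exact this hb ha (le_of_not_ge h)
  have h1 := Real.rpow_add_le_add_rpow (sub_nonneg.mpr h) hb hα₀.le hα₁
  rw [sub_add_cancel] at h1
  rw [abs_of_nonneg (sub_nonneg.mpr (Real.rpow_le_rpow hb h hα₀.le)), abs_of_nonneg (sub_nonneg.mpr h)]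
  linarith

/-- A tent function around `c` of radius `r`, raised to the power `α`. -/
noncomputable def bump {X : Type*} [Dist X] (α r : ℝ) (c x : X) : ℝ := max 0 (r - dist x c) ^ α

section Bump

variable {X : Type*} [PseudoMetricSpace X] {α r : ℝ} {c x y : X}

theorem bump_nonneg : 0 ≤ bump α r c x := Real.rpow_nonneg (le_max_left _ _) _

theorem bump_le (hα : 0 < α) (hr : 0 ≤ r) : bump α r c x ≤ r ^ α :=
  Real.rpow_le_rpow (le_max_left _ _) (max_le hr (by linarith [dist_nonneg (x := x) (y := c)])) hα.le

theorem bump_eq_zero (hα : 0 < α) (h : r ≤ dist x c) : bump α r c x = 0 := by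
  rw [bump, max_eq_left (by linarith), Real.zero_rpow hα.ne']

theorem le_bump {q : ℝ} (hα : 0 < α) (hq : 0 ≤ q) (h : dist x c ≤ r - q) : q ^ α ≤ bump α r c x :=
  Real.rpow_le_rpow hq (le_max_of_le_right (by linarith)) hα.le

/-- The tent is 1-Lipschitz, and t ↦ t ^ α is α-Hölder with constant 1 by subadditivity. -/
theorem abs_bump_sub_le (hα₀ : 0 < α) (hα₁ : α ≤ 1) :
    |bump α r c x - bump α r c y| ≤ dist x y ^ α := by
  refine (abs_rpow_sub_rpow_le hα₀ hα₁ (le_max_left _ _) (le_max_left _ _)).trans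
    (Real.rpow_le_rpow (abs_nonneg _) ?_ hα₀.le)
  rw [max_comm 0, max_comm 0]
  refine (abs_max_sub_max_le_abs _ _ 0).trans ?_
  rw [sub_sub_sub_cancel_left, abs_sub_comm]
  exact abs_dist_sub_le x y c

theorem measurable_bump [MeasurableSpace X] [OpensMeasurableSpace X] (α r : ℝ) (c : X) :
    Measurable (bump α r c) := by
  unfold bump
  have : Measurable fun x => dist x c := (continuous_id.dist continuous_const).measurable
  fun_prop

end Bump

/-! ### The grid of cells and the hypercube of regression functions -/

section Grid

variable {d N : ℕ}

/-- The centre of the cell `j` in the partition of the cube into cells of side `1 / N`. -/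
noncomputable def cellCenter (j : Fin d → Fin N) : Cube d := fun ℓ =>
  ⟨((j ℓ : ℝ) + 1 / 2) / N, by
    have hN : (0 : ℝ) < N := by exact_mod_cast (j ℓ).pos
    have : ((j ℓ : ℕ) : ℝ) + 1 ≤ N := by exact_mod_cast (j ℓ).isLt
    constructor
    · positivity
    · rw [div_le_one hN]; linarith⟩

/-- The distance is the sup distance, so one differing index is enough. Balls of radius 1 / (2N) are
then disjoint open boxes of side 1 / N. -/
theorem one_div_le_dist_cellCenter {j k : Fin d → Fin N} (h : j ≠ k) :
    1 / (N : ℝ) ≤ dist (cellCenter j) (cellCenter k) := by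
  obtain ⟨ℓ, hℓ⟩ := Function.ne_iff.mp h
  have hN : (0 : ℝ) < N := by exact_mod_cast (j ℓ).pos
  refine le_trans ?_ (dist_le_pi_dist _ _ ℓ)
  rw [Subtype.dist_eq, Real.dist_eq]
  simp only [cellCenter]
  rw [← sub_div, abs_div, abs_of_pos hN]
  gcongr
  have : ((j ℓ : ℕ) : ℤ) - ((k ℓ : ℕ) : ℤ) ≠ 0 := by
    intro h0
    exact hℓ (Fin.ext (by omega))
  have h1 := Int.one_le_abs this
  have h2 : ((1 : ℤ) : ℝ) ≤ ((|((j ℓ : ℕ) : ℤ) - ((k ℓ : ℕ) : ℤ)| : ℤ) : ℝ) := by exact_mod_cast h1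
  push_cast at h2
  rwa [add_sub_add_right_eq_sub]

theorem volume_ball_unitInterval_le (t : unitInterval) (r : ℝ) :
    volume (Metric.ball t r) ≤ ENNReal.ofReal (2 * r) := by
  rw [unitInterval.volume_apply, ← Real.volume_ball (t : ℝ) r]
  refine measure_mono ?_
  rintro _ ⟨x, hx, rfl⟩
  exact hx

theorem le_volume_closedBall_cellCenter (j : Fin d → Fin N) :
    ENNReal.ofReal (1 / (2 * N)) ^ d ≤
      volume (Metric.closedBall (cellCenter j) (1 / (4 * N))) := by
  rw [closedBall_pi _ (by positivity), volume_pi_pi]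
  have key : ∀ ℓ : Fin d, ENNReal.ofReal (1 / (2 * N)) ≤
      volume (Metric.closedBall (cellCenter j ℓ) (1 / (4 * N))) := by
    intro ℓ
    have hN : (0 : ℝ) < N := by exact_mod_cast (j ℓ).pos
    have hj : ((j ℓ : ℕ) : ℝ) + 1 ≤ N := by exact_mod_cast (j ℓ).isLt
    have hj0 : (0 : ℝ) ≤ ((j ℓ : ℕ) : ℝ) := by positivity
    rw [unitInterval.volume_apply, show 1 / (2 * (N : ℝ)) = 2 * (1 / (4 * N)) by field_simp; norm_num,
      ← Real.volume_closedBall (cellCenter j ℓ : ℝ)]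
    refine measure_mono ?_
    intro t ht
    have hc : (cellCenter j ℓ : ℝ) = ((j ℓ : ℝ) + 1 / 2) / N := rfl
    have ht' := ht
    rw [Real.closedBall_eq_Icc, hc, Set.mem_Icc] at ht'
    have e1 : ((j ℓ : ℝ) + 1 / 2) / N - 1 / (4 * N) = ((j ℓ : ℝ) + 1 / 4) / N := by
      field_simp; ring
    have e2 : ((j ℓ : ℝ) + 1 / 2) / N + 1 / (4 * N) = ((j ℓ : ℝ) + 3 / 4) / N := by
      field_simp; ring
    rw [e1, e2] at ht'
    have h0 : 0 ≤ ((j ℓ : ℝ) + 1 / 4) / N := by positivity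
    have h1 : ((j ℓ : ℝ) + 3 / 4) / N ≤ 1 := by rw [div_le_one hN]; linarith
    exact ⟨⟨t, by linarith [ht'.1], by linarith [ht'.2]⟩, ht, rfl⟩
  calc ENNReal.ofReal (1 / (2 * N)) ^ d = ∏ _ : Fin d, ENNReal.ofReal (1 / (2 * N)) := by simp
    _ ≤ _ := Finset.prod_le_prod' fun ℓ _ => key ℓ

/-- Bumps are built from the sup distance so that their supports are boxes; this inequality
transfers their Hölder bound to the Euclidean norm. -/
theorem dist_le_norm_toLp (x y : Cube d) :
    dist x y ≤ ‖WithLp.toLp 2 (fun ℓ : Fin d => (x ℓ : ℝ) - (y ℓ : ℝ))‖ := by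
  refine (dist_pi_le_iff (norm_nonneg _)).mpr fun ℓ => ?_
  rw [Subtype.dist_eq, Real.dist_eq, ← Real.norm_eq_abs]
  exact PiLp.norm_apply_le (p := 2) (WithLp.toLp 2 (fun ℓ : Fin d => (x ℓ : ℝ) - (y ℓ : ℝ))) ℓ

/-- The bump supported in the cell `j`. -/
noncomputable def cellBump (α : ℝ) (j : Fin d → Fin N) : Cube d → ℝ :=
  bump α (1 / (2 * N)) (cellCenter j)

theorem cellBump_nonneg (α : ℝ) (j : Fin d → Fin N) (x : Cube d) : 0 ≤ cellBump α j x :=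
  bump_nonneg

theorem cellBump_eq_zero {α : ℝ} (hα : 0 < α) {j : Fin d → Fin N} {x : Cube d}
    (h : x ∉ Metric.ball (cellCenter j) (1 / (2 * N))) : cellBump α j x = 0 :=
  bump_eq_zero hα (not_lt.mp h)

theorem pairwise_disjoint_ball_cellCenter : Pairwise (Function.onFun Disjoint
    fun j : Fin d → Fin N => Metric.ball (cellCenter j) (1 / (2 * N))) := by
  intro j k hjk
  refine Metric.ball_disjoint_ball ?_
  refine le_trans (le_of_eq ?_) (one_div_le_dist_cellCenter hjk)
  obtain ⟨ℓ, -⟩ := Function.ne_iff.mp hjk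
  have hN : (0 : ℝ) < N := by exact_mod_cast (j ℓ).pos
  field_simp; norm_num

theorem cellBump_disjoint {α : ℝ} (hα : 0 < α) (i j : Fin d → Fin N) (x : Cube d) (hij : i ≠ j)
    (h : cellBump α i x ≠ 0) : cellBump α j x = 0 := by
  have hi : x ∈ Metric.ball (cellCenter i) (1 / (2 * N)) := by
    by_contra hc; exact h (cellBump_eq_zero hα hc)
  exact cellBump_eq_zero hα (Set.disjoint_left.mp (pairwise_disjoint_ball_cellCenter hij) hi)

/-- The regression function with bumps of height `A` and signs `σ` on the cells. -/
noncomputable def signedBumps (α A : ℝ) (σ : (Fin d → Fin N) → Bool) (x : Cube d) : ℝ :=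
  A * ∑ j, bitSign (σ j) * cellBump α j x

theorem measurable_signedBumps (α A : ℝ) (σ : (Fin d → Fin N) → Bool) :
    Measurable (signedBumps α A σ) := by
  unfold signedBumps
  refine Measurable.const_mul (Finset.measurable_fun_sum _ fun j _ => ?_) _
  exact (measurable_bump _ _ _).const_mul _

/-- The radius gives 1 / (2N); the cruder 1 / N lets the height and the side of the box be powers of
one quantity. -/
theorem cellBump_le {α : ℝ} (hα : 0 < α) (j : Fin d → Fin N) (x : Cube d) :
    cellBump α j x ≤ (1 / (N : ℝ)) ^ α := by
  refine (bump_le hα (by positivity)).trans (Real.rpow_le_rpow (by positivity) ?_ hα.le)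
  rcases Nat.eq_zero_or_pos N with rfl | hN
  · simp
  · have : (0 : ℝ) < N := by exact_mod_cast hN
    gcongr; linarith

theorem nonempty_cells (hN : 1 ≤ N) : Nonempty (Fin d → Fin N) := ⟨fun _ => ⟨0, hN⟩⟩

theorem one_div_rpow_le_one {α : ℝ} (hα : 0 < α) (hN : 1 ≤ N) : (1 / (N : ℝ)) ^ α ≤ 1 := by
  refine Real.rpow_le_one (by positivity) ?_ hα.le
  have : (1 : ℝ) ≤ N := by exact_mod_cast hN
  rw [div_le_one (by linarith)]; exact this

theorem abs_signedBumps_le {α A : ℝ} (hα : 0 < α) (hA : 0 ≤ A) (hN : 1 ≤ N)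
    (σ : (Fin d → Fin N) → Bool) (x : Cube d) : |signedBumps α A σ x| ≤ A := by
  have := nonempty_cells (d := d) hN
  rw [signedBumps, abs_mul, abs_of_nonneg hA]
  refine mul_le_of_le_one_right hA (abs_sum_bitSign_le (cellBump_disjoint hα) σ fun i => ?_)
  rw [abs_of_nonneg (cellBump_nonneg α i x)]
  exact (cellBump_le hα i x).trans (one_div_rpow_le_one hα hN)

theorem isHolder_signedBumps {α A cL : ℝ} (hα₀ : 0 < α) (hα₁ : α ≤ 1) (hA : 0 ≤ A)
    (hcL : 2 * A ≤ cL) (hN : 1 ≤ N) (σ : (Fin d → Fin N) → Bool) :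
    IsHolder α cL (signedBumps α A σ) := by
  intro x y
  have := nonempty_cells (d := d) hN
  set D := ‖WithLp.toLp 2 (fun ℓ : Fin d => (x ℓ : ℝ) - (y ℓ : ℝ))‖
  have hD : dist x y ^ α ≤ D ^ α := Real.rpow_le_rpow dist_nonneg (dist_le_norm_toLp x y) hα₀.le
  have h1 := abs_sum_bitSign_sub_le (cellBump_disjoint hα₀) σ
    (fun i : Fin d → Fin N => (abs_bump_sub_le hα₀ hα₁ :
      |cellBump α i x - cellBump α i y| ≤ dist x y ^ α))
  have hD0 : 0 ≤ D ^ α := Real.rpow_nonneg (norm_nonneg _) _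
  rw [signedBumps, signedBumps, ← mul_sub, abs_mul, abs_of_nonneg hA]
  calc _ ≤ A * (2 * D ^ α) := by gcongr; linarith
    _ = 2 * A * D ^ α := by ring
    _ ≤ cL * D ^ α := by gcongr

theorem signedBumps_eq_on_ball {α A : ℝ} (hα : 0 < α) (σ : (Fin d → Fin N) → Bool)
    {j : Fin d → Fin N} {x : Cube d} (hx : x ∈ Metric.ball (cellCenter j) (1 / (2 * N))) :
    signedBumps α A σ x = A * (bitSign (σ j) * cellBump α j x) := by
  rw [signedBumps, sum_bitSign_eq σ fun k hk =>
    cellBump_eq_zero hα (Set.disjoint_left.mp (pairwise_disjoint_ball_cellCenter hk.symm) hx)]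

theorem signedBumps_flip_sub [DecidableEq (Fin d → Fin N)] (α A : ℝ) (σ : (Fin d → Fin N) → Bool)
    (j : Fin d → Fin N) (x : Cube d) :
    signedBumps α A (Function.update σ j (!σ j)) x - signedBumps α A σ x =
      -(2 * A * bitSign (σ j)) * cellBump α j x := by
  rw [signedBumps, signedBumps, ← mul_sub, ← Finset.sum_sub_distrib,
    Finset.sum_eq_single j _ (by simp)]
  · rw [Function.update_self, bitSign_not]; ring
  · intro k _ hk
    rw [Function.update_of_ne hk, sub_self]

end Grid

/-! ### Assouad averaging and cellwise losses -/

/-- Averaging over the vertices of the hypercube. -/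
theorem card_mul_le_of_flip {ι : Type*} [Fintype ι] [DecidableEq ι] {a : ι → (ι → Bool) → ℝ≥0∞}
    {B c : ℝ≥0∞} (hB : ∀ σ, ∑ j, a j σ ≤ B)
    (hc : ∀ j σ, c ≤ a j σ + a j (Function.update σ j (!σ j))) : Fintype.card ι * c ≤ 2 * B := by
  -- Flipping the bit j is an involution of the hypercube, so it only permutes the sum over σ.
  have hflip : ∀ j, ∑ σ, a j (Function.update σ j (!σ j)) = ∑ σ, a j σ := by
    intro j
    have hinv : Function.Involutive fun σ : ι → Bool => Function.update σ j (!σ j) := by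
      intro σ; simp
    exact Equiv.sum_comp hinv.toPerm (a j)
  have h1 : ∀ j, (Fintype.card (ι → Bool) : ℝ≥0∞) * c ≤ 2 * ∑ σ, a j σ := by
    intro j
    calc (Fintype.card (ι → Bool) : ℝ≥0∞) * c = ∑ _σ : ι → Bool, c := by simp
      _ ≤ ∑ σ, (a j σ + a j (Function.update σ j (!σ j))) := Finset.sum_le_sum fun σ _ => hc j σ
      _ = 2 * ∑ σ, a j σ := by rw [Finset.sum_add_distrib, hflip, two_mul]
  have h2 : (Fintype.card (ι → Bool) : ℝ≥0∞) * (Fintype.card ι * c) ≤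
      (Fintype.card (ι → Bool) : ℝ≥0∞) * (2 * B) := by
    calc (Fintype.card (ι → Bool) : ℝ≥0∞) * (Fintype.card ι * c)
        = ∑ _j : ι, (Fintype.card (ι → Bool) : ℝ≥0∞) * c := by
          rw [Finset.sum_const, nsmul_eq_mul, Finset.card_univ]; ring
      _ ≤ ∑ j, 2 * ∑ σ, a j σ := Finset.sum_le_sum fun j _ => h1 j
      _ = 2 * ∑ σ, ∑ j, a j σ := by rw [← Finset.mul_sum, Finset.sum_comm]
      _ ≤ 2 * ∑ _σ : ι → Bool, B := by gcongr with σ; exact hB σ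
      _ = _ := by rw [Finset.sum_const, nsmul_eq_mul, Finset.card_univ]; ring
  exact (ENNReal.mul_le_mul_iff_right (by simp) (by simp)).mp h2

section CellLoss

variable {d N : ℕ}

/-- The squared loss on the cell `j` against a bump of height `A` and sign `b`. -/
noncomputable def cellLoss (α A : ℝ) (j : Fin d → Fin N) (b : Bool) (f : Cube d → ℝ) : ℝ≥0∞ :=
  ∫⁻ x in Metric.ball (cellCenter j) (1 / (2 * N)),
    ENNReal.ofReal ((f x - A * (bitSign b * cellBump α j x)) ^ 2)

theorem measurable_cellBump (α : ℝ) (j : Fin d → Fin N) : Measurable (cellBump α j) :=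
  measurable_bump _ _ _

/-- Pointwise, (f - a)² + (f + a)² ≥ 2 a². The bump is at least (1 / (4N)) ^ α on the concentric
closed ball of half the radius, whose volume is at least (1 / (2N)) ^ d. -/
theorem le_cellLoss_add_cellLoss_not {α A : ℝ} (hα : 0 < α) (hN : 1 ≤ N) (j : Fin d → Fin N)
    (b : Bool) {f : Cube d → ℝ} (hf : Measurable f) :
    ENNReal.ofReal (2 * (A ^ 2 * ((1 / (4 * (N : ℝ))) ^ α) ^ 2 * (1 / (2 * (N : ℝ))) ^ d)) ≤
      cellLoss α A j b f + cellLoss α A j (!b) f := by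
  have hN' : (0 : ℝ) < N := by exact_mod_cast hN
  have mb := measurable_cellBump α j
  rw [cellLoss, cellLoss, ← lintegral_add_left (by fun_prop)]
  have hsub : Metric.closedBall (cellCenter j) (1 / (4 * (N : ℝ))) ⊆
      Metric.ball (cellCenter j) (1 / (2 * (N : ℝ))) :=
    Metric.closedBall_subset_ball (by gcongr; norm_num)
  refine le_trans ?_ (lintegral_mono_set hsub)
  calc ENNReal.ofReal (2 * (A ^ 2 * ((1 / (4 * (N : ℝ))) ^ α) ^ 2 * (1 / (2 * (N : ℝ))) ^ d))
      = ENNReal.ofReal (2 * (A ^ 2 * ((1 / (4 * (N : ℝ))) ^ α) ^ 2)) *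
          ENNReal.ofReal (1 / (2 * N)) ^ d := by
        rw [← ENNReal.ofReal_pow (by positivity), ← ENNReal.ofReal_mul (by positivity)]
        congr 1; ring
    _ ≤ ENNReal.ofReal (2 * (A ^ 2 * ((1 / (4 * (N : ℝ))) ^ α) ^ 2)) *
          volume (Metric.closedBall (cellCenter j) (1 / (4 * (N : ℝ)))) := by
        gcongr; exact le_volume_closedBall_cellCenter j
    _ = ∫⁻ _ in Metric.closedBall (cellCenter j) (1 / (4 * (N : ℝ))),
          ENNReal.ofReal (2 * (A ^ 2 * ((1 / (4 * (N : ℝ))) ^ α) ^ 2)) := by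
        rw [setLIntegral_const]
    _ ≤ _ := by
        refine setLIntegral_mono' Metric.isClosed_closedBall.measurableSet fun x hx => ?_
        rw [← ENNReal.ofReal_add (by positivity) (by positivity), bitSign_not]
        apply ENNReal.ofReal_le_ofReal
        have h1 : (1 / (4 * (N : ℝ))) ^ α ≤ cellBump α j x := by
          refine le_bump hα (by positivity) (le_trans hx (le_of_eq ?_))
          field_simp; norm_num
        have h2 : ((1 / (4 * (N : ℝ))) ^ α) ^ 2 ≤ cellBump α j x ^ 2 :=
          pow_le_pow_left₀ (by positivity) h1 2
        have h3 : bitSign b ^ 2 = 1 := by rw [← sq_abs, abs_bitSign, one_pow]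
        have h4 : (f x - A * (bitSign b * cellBump α j x)) ^ 2 +
            (f x - A * (-bitSign b * cellBump α j x)) ^ 2 =
            2 * f x ^ 2 + 2 * (A ^ 2 * (bitSign b ^ 2 * cellBump α j x ^ 2)) := by ring
        rw [h4, h3, one_mul]
        nlinarith [mul_le_mul_of_nonneg_left h2 (sq_nonneg A), sq_nonneg (f x)]

theorem sum_cellLoss_le {α A : ℝ} (hα : 0 < α) (σ : (Fin d → Fin N) → Bool) (f : Cube d → ℝ) :
    ∑ j, cellLoss α A j (σ j) f ≤ ∫⁻ x, ENNReal.ofReal ((f x - signedBumps α A σ x) ^ 2) := by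
  calc ∑ j, cellLoss α A j (σ j) f
      = ∑ j, ∫⁻ x in Metric.ball (cellCenter j) (1 / (2 * (N : ℝ))),
          ENNReal.ofReal ((f x - signedBumps α A σ x) ^ 2) := by
        refine Finset.sum_congr rfl fun j _ => ?_
        refine setLIntegral_congr_fun Metric.isOpen_ball.measurableSet fun x hx => ?_
        simp only [signedBumps_eq_on_ball hα σ hx]
    _ = ∫⁻ x in ⋃ j : Fin d → Fin N, Metric.ball (cellCenter j) (1 / (2 * (N : ℝ))),
          ENNReal.ofReal ((f x - signedBumps α A σ x) ^ 2) := by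
        rw [lintegral_iUnion (fun j => Metric.isOpen_ball.measurableSet)
          pairwise_disjoint_ball_cellCenter, tsum_fintype]
    _ ≤ _ := setLIntegral_le_lintegral _ _

theorem measurable_cellLoss {Ω : Type*} [MeasurableSpace Ω] (α A : ℝ) (j : Fin d → Fin N) (b : Bool)
    {f : Ω → Cube d → ℝ} (hf : Measurable (Function.uncurry f)) :
    Measurable fun z => cellLoss α A j b (f z) := by
  have mb := measurable_cellBump α j
  unfold cellLoss
  refine Measurable.lintegral_prod_right' (f := fun p : Ω × Cube d =>
    ENNReal.ofReal ((f p.1 p.2 - A * (bitSign b * cellBump α j p.2)) ^ 2)) ?_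
  have : Measurable fun p : Ω × Cube d => f p.1 p.2 := hf
  fun_prop

end CellLoss

/-! ### The minimax bound at a given resolution and the choice of resolution -/

section Minimax

variable {d n N : ℕ} {M : ℝ} {S : Type u} [MeasurableSpace S]

/-- The minimax bound that the cells of side `1 / N` give when the mechanism cannot detect the sign
of a single bump. -/
theorem le_iSup_of_labelSensitive (hM : 0 < M) {s : ℕ} (hs : s ≤ d) {α cL cLow cUp A k : ℝ}
    (hα₀ : 0 < α) (hα₁ : α ≤ 1) (hcLow : cLow ≤ 1) (hcUp : 1 ≤ cUp) (hA : 0 ≤ A) (hAM : A ≤ M / 2)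
    (hAc : 2 * A ≤ cL) (hk : 0 ≤ k) (hN : 1 ≤ N) (R : SeqMechanism d n M S)
    (hR : ∀ i z, LabelSensitive hM ((R.kernel i).sectL z) s k)
    (hres : n * (2 * ((1 / (N : ℝ)) ^ α) ^ 2 * k ^ 2 * (1 / (N : ℝ)) ^ (d + s)) ≤ 1)
    {f : (Fin n → S) → Cube d → ℝ} (hf : Measurable (Function.uncurry f)) :
    ENNReal.ofReal (A ^ 2 * ((1 / (4 * (N : ℝ))) ^ α) ^ 2 * (1 / 2) ^ d / 24) ≤
      ⨆ (P : Measure (Sample d M)) (_ : InClass α cL cLow cUp P),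
        ∫⁻ z, excessRisk P (f z) ∂(R.transcriptLaw P n le_rfl) := by
  classical
  have hN' : (0 : ℝ) < N := by exact_mod_cast hN
  set B := ⨆ (P : Measure (Sample d M)) (_ : InClass α cL cLow cUp P),
        ∫⁻ z, excessRisk P (f z) ∂(R.transcriptLaw P n le_rfl)
  have hfz : ∀ z, Measurable (f z) := fun z => hf.comp (by fun_prop : Measurable fun x => (z, x))
  have ms := measurable_signedBumps (d := d) (N := N) α A
  have bs : ∀ (σ : (Fin d → Fin N) → Bool) x, |signedBumps α A σ x| ≤ M / 2 := fun σ x =>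
    (abs_signedBumps_le hα₀ hA hN σ x).trans hAM
  have bs' : ∀ (σ : (Fin d → Fin N) → Bool) x, |signedBumps α A σ x| ≤ M := fun σ x =>
    (bs σ x).trans (by linarith)
  let P : ((Fin d → Fin N) → Bool) → Measure (Sample d M) := fun σ => twoPointLaw hM (signedBumps α A σ)
  have hP : ∀ σ, IsProbabilityMeasure (P σ) := fun σ =>
    isProbabilityMeasure_twoPointLaw hM (ms σ) (bs' σ)
  have hPc : ∀ σ, InClass α cL cLow cUp (P σ) := fun σ =>
    inClass_twoPointLaw hM hcLow hcUp (ms σ) (bs' σ) (isHolder_signedBumps hα₀ hα₁ hA hAc hN σ)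
  have hT : ∀ σ, IsProbabilityMeasure (R.transcriptLaw (P σ) n le_rfl) := fun σ =>
    R.isProbabilityMeasure_transcriptLaw (P σ) n le_rfl
  have hB : ∀ σ, ∑ j, ∫⁻ z, cellLoss α A j (σ j) (f z) ∂(R.transcriptLaw (P σ) n le_rfl) ≤ B := by
    intro σ
    rw [← lintegral_finsetSum _ fun j _ => measurable_cellLoss α A j (σ j) hf]
    refine le_trans (lintegral_mono fun z => ?_) (le_iSup₂_of_le (P σ) (hPc σ) le_rfl)
    exact (sum_cellLoss_le hα₀ σ (f z)).trans (le_excessRisk_twoPointLaw hM (ms σ) (bs' σ) (hfz z))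
  set δ := 2 * ((1 / (N : ℝ)) ^ α) ^ 2 * k ^ 2 * (1 / (N : ℝ)) ^ (d + s)
  have hδ : 0 ≤ δ := by positivity
  -- The product of the n costs is at most exp(n δ) ≤ e ≤ 3, the threshold in the testing lemma.
  have hK : ENNReal.ofReal (1 + δ) ^ n ≤ 3 := by
    rw [← ENNReal.ofReal_pow (by positivity), show (3 : ℝ≥0∞) = ENNReal.ofReal 3 by simp]
    apply ENNReal.ofReal_le_ofReal
    calc (1 + δ) ^ n ≤ Real.exp δ ^ n := by
          gcongr; linarith [Real.add_one_le_exp δ]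
      _ = Real.exp (n * δ) := (Real.exp_nat_mul δ n).symm
      _ ≤ Real.exp 1 := Real.exp_le_exp.mpr hres
      _ ≤ 3 := Real.exp_one_lt_three.le
  set Δ := A ^ 2 * ((1 / (4 * (N : ℝ))) ^ α) ^ 2 * (1 / (2 * (N : ℝ))) ^ d with hΔ
  have hΔ0 : 0 ≤ Δ := by positivity
  have hpair : ∀ j σ, ENNReal.ofReal (Δ / 12) ≤
      ∫⁻ z, cellLoss α A j (σ j) (f z) ∂(R.transcriptLaw (P σ) n le_rfl) +
      ∫⁻ z, cellLoss α A j (Function.update σ j (!σ j) j) (f z)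
        ∂(R.transcriptLaw (P (Function.update σ j (!σ j))) n le_rfl) := by
    intro j σ
    have hball : Set.univ.pi (fun ℓ => Metric.ball (cellCenter j ℓ) (1 / (2 * (N : ℝ)))) =
        Metric.ball (cellCenter j) (1 / (2 * (N : ℝ))) := (ball_pi _ (by positivity)).symm
    have hstep : ∀ (i : Fin n) (z : Fin i → S), ChiSqBound (ENNReal.ofReal (1 + δ))
        ((R.kernel i).sectL z ∘ₘ P (Function.update σ j (!σ j))) ((R.kernel i).sectL z ∘ₘ P σ) := by
      intro i z
      have := R.isMarkovKernel i
      refine chiSqBound_comp_twoPointLaw hM _ hs hk (hR i z) (ms _) (ms _) (bs _) (bs _)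
        (I := fun ℓ => Metric.ball (cellCenter j ℓ) (1 / (2 * (N : ℝ))))
        (fun ℓ => Metric.isOpen_ball.measurableSet) (by positivity) (fun ℓ => ?_) (by positivity)
        (fun x => ?_) (fun x hx => ?_)
      · refine (volume_ball_unitInterval_le _ _).trans_eq ?_
        congr 1; field_simp
      · rw [signedBumps_flip_sub, abs_mul, abs_neg, abs_mul, abs_bitSign, mul_one,
          abs_of_nonneg (by positivity : 0 ≤ 2 * A), abs_of_nonneg (cellBump_nonneg _ _ _)]
        -- A flip changes the function by 2A times the bump, and 2A ≤ M, so b = (1 / N) ^ α is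
        -- admissible.
        exact mul_le_mul (by linarith) (cellBump_le hα₀ j x) (cellBump_nonneg _ _ _) hM.le
      · rw [hball] at hx
        rw [← sub_eq_zero, signedBumps_flip_sub, cellBump_eq_zero hα₀ hx, mul_zero]
    refine le_add_lintegral_of_chiSqBound hK
      (R.chiSqBound_transcriptLaw ENNReal.ofReal_ne_top hstep n le_rfl)
      (measurable_cellLoss α A j _ hf) hΔ0 fun z => ?_
    rw [Function.update_self]
    exact le_cellLoss_add_cellLoss_not hα₀ hN j (σ j) (hfz z)
  have hmain := card_mul_le_of_flip
    (a := fun j σ => ∫⁻ z, cellLoss α A j (σ j) (f z) ∂(R.transcriptLaw (P σ) n le_rfl)) hB hpair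
  -- The N^d cells cancel the factor N^(-d) in Δ, leaving 2^(-d).
  have hcard : (Fintype.card (Fin d → Fin N) : ℝ≥0∞) * ENNReal.ofReal (Δ / 12) =
      2 * ENNReal.ofReal (A ^ 2 * ((1 / (4 * (N : ℝ))) ^ α) ^ 2 * (1 / 2) ^ d / 24) := by
    rw [Fintype.card_fun, Fintype.card_fin, Fintype.card_fin,
      show (2 : ℝ≥0∞) = ENNReal.ofReal 2 by simp, ← ENNReal.ofReal_natCast,
      ← ENNReal.ofReal_mul (by positivity), ← ENNReal.ofReal_mul (by positivity)]
    congr 1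
    have : (N : ℝ) ^ d * (1 / (2 * (N : ℝ))) ^ d = (1 / 2) ^ d := by
      rw [← mul_pow]; congr 1; field_simp
    rw [hΔ, ← this]
    push_cast
    ring
  rw [hcard] at hmain
  exact (ENNReal.mul_le_mul_iff_right (by norm_num) (by norm_num)).mp hmain

/-- N is (2u) ^ (1 / γ) rounded up, or 1 when 2u ≤ 1; the latter regime produces the minimum with 1.
-/
theorem exists_resolution {α γ u : ℝ} (hα : 0 < α) (hγ : 2 * α ≤ γ) (hu : 0 < u) :
    ∃ N : ℕ, 1 ≤ N ∧ 2 * u * (1 / (N : ℝ)) ^ γ ≤ 1 ∧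
      (1 / 8) ^ (2 * α) / 2 * min 1 (u ^ (-(2 * α / γ))) ≤ (1 / (4 * (N : ℝ))) ^ (2 * α) := by
  have hγ0 : 0 < γ := by linarith
  rcases le_total (2 * u) 1 with h | h
  · refine ⟨1, le_rfl, by simpa using h, ?_⟩
    have h1 : (1 / 8 : ℝ) ^ (2 * α) ≤ (1 / 4) ^ (2 * α) :=
      Real.rpow_le_rpow (by norm_num) (by norm_num) (by positivity)
    have h2 : 0 ≤ (1 / 8 : ℝ) ^ (2 * α) := by positivity
    have h3 : min 1 (u ^ (-(2 * α / γ))) ≤ 1 := min_le_left _ _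
    have h4 : (1 / (4 * ((1 : ℕ) : ℝ))) = 1 / 4 := by norm_num
    rw [h4]
    nlinarith [mul_le_mul_of_nonneg_left h3 h2]
  · set t := (2 * u) ^ (1 / γ) with ht
    have ht1 : 1 ≤ t := Real.one_le_rpow h (by positivity)
    have hceil : t ≤ ⌈t⌉₊ := Nat.le_ceil t
    -- Rounding up at most doubles t because t ≥ 1; hence 1/8 in place of 1/4.
    have hN2 : (⌈t⌉₊ : ℝ) ≤ 2 * t := by linarith [Nat.ceil_lt_add_one (by linarith : 0 ≤ t)]
    have htγ : t ^ γ = 2 * u := by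
      rw [ht, ← Real.rpow_mul (by positivity), one_div_mul_cancel hγ0.ne', Real.rpow_one]
    refine ⟨⌈t⌉₊, Nat.one_le_ceil_iff.mpr (by linarith), ?_, ?_⟩
    · rw [one_div, Real.inv_rpow (by positivity), ← htγ, ← div_eq_mul_inv]
      exact div_le_one_of_le₀ (Real.rpow_le_rpow (by linarith) hceil hγ0.le) (by positivity)
    · have h1 : 1 / 8 * t⁻¹ ≤ 1 / (4 * (⌈t⌉₊ : ℝ)) := by
        rw [← one_div, one_div_mul_one_div]
        apply one_div_le_one_div_of_le <;> linarith
      refine le_trans ?_ (Real.rpow_le_rpow (by positivity) h1 (by positivity))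
      rw [Real.mul_rpow (by norm_num) (by positivity), div_mul_eq_mul_div, mul_div_assoc]
      gcongr
      have h2 : t⁻¹ ^ (2 * α) = 2 ^ (-(2 * α / γ)) * u ^ (-(2 * α / γ)) := by
        rw [← Real.mul_rpow (by norm_num) hu.le, Real.inv_rpow (by positivity),
          ← Real.rpow_neg (by positivity), ht, ← Real.rpow_mul (by positivity)]
        congr 1; field_simp
      -- The 2 in t = (2u) ^ (1 / γ) costs at most a factor 1/2, because 2α ≤ γ.
      have h3 : (1 / 2 : ℝ) ≤ 2 ^ (-(2 * α / γ)) := by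
        rw [one_div, ← Real.rpow_neg_one]
        apply Real.rpow_le_rpow_of_exponent_le (by norm_num)
        rw [neg_le_neg_iff, div_le_one hγ0]; exact hγ
      rw [h2]
      have h4 := min_le_right (1 : ℝ) (u ^ (-(2 * α / γ)))
      have h5 : 0 ≤ u ^ (-(2 * α / γ)) := by positivity
      nlinarith

/-- The minimax lower bound for mechanisms with a given label sensitivity. -/
theorem le_iSup_rate_of_labelSensitive (hM : 0 < M) {s : ℕ} (hs : s ≤ d) {α cL cLow cUp A k : ℝ}
    (hα₀ : 0 < α) (hα₁ : α ≤ 1) (hcLow : cLow ≤ 1) (hcUp : 1 ≤ cUp) (hA : 0 ≤ A) (hAM : A ≤ M / 2)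
    (hAc : 2 * A ≤ cL) (hk : 0 < k) (hn : 1 ≤ n) (R : SeqMechanism d n M S)
    (hR : ∀ i z, LabelSensitive hM ((R.kernel i).sectL z) s k)
    {f : (Fin n → S) → Cube d → ℝ} (hf : Measurable (Function.uncurry f)) :
    ENNReal.ofReal (A ^ 2 * (1 / 8) ^ (2 * α) * (1 / 2) ^ d / 48 *
        min 1 (((n : ℝ) * k ^ 2) ^ (-(2 * α / (2 * α + d + s))))) ≤
      ⨆ (P : Measure (Sample d M)) (_ : InClass α cL cLow cUp P),
        ∫⁻ z, excessRisk P (f z) ∂(R.transcriptLaw P n le_rfl) := by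
  have hn' : (0 : ℝ) < n := by exact_mod_cast hn
  obtain ⟨N, hN, hres, hrate⟩ := exists_resolution (α := α) (γ := 2 * α + d + s)
    (u := n * k ^ 2) hα₀ (by have : (0:ℝ) ≤ (d : ℝ) + s := by positivity
                             linarith) (by positivity)
  have hN' : (0 : ℝ) < N := by exact_mod_cast hN
  have hsq : ∀ x : ℝ, 0 ≤ x → (x ^ α) ^ 2 = x ^ (2 * α) := fun x hx => by
    rw [← Real.rpow_natCast, ← Real.rpow_mul hx, mul_comm α]; norm_num
  refine le_trans (ENNReal.ofReal_le_ofReal ?_)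
    (le_iSup_of_labelSensitive hM hs hα₀ hα₁ hcLow hcUp hA hAM hAc hk.le hN R hR ?_ hf)
  · rw [hsq _ (by positivity)]
    have := mul_le_mul_of_nonneg_left hrate (by positivity : 0 ≤ A ^ 2 * (1 / 2) ^ d / 24)
    refine le_trans (le_of_eq ?_) (this.trans (le_of_eq ?_)) <;> ring
  · refine le_trans (le_of_eq ?_) hres
    rw [hsq _ (by positivity), add_assoc (2 * α), Real.rpow_add (by positivity), ← Nat.cast_add,
      Real.rpow_natCast]
    ring

end Minimax

/-! ### The private and the non-private rate together -/

theorem theorem1 (d s : ℕ) (hd : 1 ≤ d) (hs : s ≤ d)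
    (M α cL cLow cUp : ℝ) (hM : 0 < M) (hα₀ : 0 < α) (hα₁ : α ≤ 1) (hcL : 0 < cL)
    (hcLow₀ : 0 < cLow) (hcLow₁ : cLow ≤ 1) (hcUp : 1 ≤ cUp) :
    ∃ c : ℝ, 0 < c ∧ ∀ (n : ℕ) (ε : ℝ), 1 ≤ n → 0 < ε →
      ENNReal.ofReal
          (c * max
            (min 1 (((n : ℝ) * (Real.exp ε - 1) ^ 2) ^ (-(2 * α / (2 * α + d + s)))))
            ((n : ℝ) ^ (-(2 * α / (2 * α + d)))))
        ≤ semiFeatureMinimaxRisk.{u} d s n M ε α cL cLow cUp := by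
  -- The bound cL / 2 ensures the Hölder constant 2A ≤ cL; the bound M / 2 keeps both label
  -- probabilities at least 1/4.
  set A := min (cL / 2) (M / 2)
  have hA : 0 < A := lt_min (by positivity) (by positivity)
  have hAM : A ≤ M / 2 := min_le_right _ _
  have hAc : 2 * A ≤ cL := by linarith [min_le_left (cL / 2) (M / 2)]
  refine ⟨A ^ 2 * (1 / 8) ^ (2 * α) * (1 / 2) ^ d / 48, by positivity, fun n ε hn hε => ?_⟩
  refine le_iInf fun e => ?_
  rw [mul_max_of_nonneg _ _ (by positivity), ENNReal.ofReal_max]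
  have hM' := e.mechanism.isMarkovKernel
  have hexp : 1 < Real.exp ε := Real.one_lt_exp_iff.mpr hε
  refine max_le ?_ ?_
  · refine le_iSup_rate_of_labelSensitive hM hs hα₀ hα₁ hcLow₁ hcUp hA.le hAM hAc
      (sub_pos.mpr hexp) hn e.mechanism (fun i z => ?_) e.measurable_estimate
    exact labelSensitive_of_ratio_le hM _ hexp.le fun B hB x x' hx y y' =>
      e.isLDP i B hB x x' hx y y' z
  -- The non-private rate uses no protected coordinate and sensitivity 1; the minimum with 1 is
  -- vacuous because n ≥ 1.
  · have h := le_iSup_rate_of_labelSensitive hM (Nat.zero_le d) hα₀ hα₁ hcLow₁ hcUp hA.le hAM hAc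
      one_pos hn e.mechanism (fun i z => labelSensitive_zero_one hM _) e.measurable_estimate
    rw [one_pow, mul_one, Nat.cast_zero, add_zero, min_eq_right] at h
    · exact h
    · exact Real.rpow_le_one_of_one_le_of_nonpos (by exact_mod_cast hn)
        (neg_nonpos.mpr (by positivity))
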